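/- **Setting.** Let $\ell_1,\dots,\ell_n$ ($n\ge 2$) be links in an arbitrary metric space; $\ell_v$ has sender $s_v$, receiver $r_v$, length $\ell_v=d(s_v,r_v)>0$ and power $P_v>0$. Fix $\alpha>0$ and $\beta\ge1$, and let $N\ge0$. For *uni-directional* links put $d_{wv}=d(s_w,r_v)$; for *bi-directional* links put $d_{wv}=\min(d(s_w,r_v),d(s_v,r_w),d(s_w,s_v),d(r_w,r_v))$. If $S$ is the set of transmitting links, the transmission on $\ell_v\in S$ succeeds iff $$\frac{P_v/\ell_v^{\alpha}}{\sum_{w\in S\setminus\{v\}}P_w/d_{wv}^{\alpha}+N}\ \ge\ \beta .$$ $S$ is *feasible* if all its links succeed. Each link is assumed to be feasible alone, and the scheduling number $T$ is the least size of a partition of the links into feasible sets. The power assignment is *uniform* if $P_v$ is constant, *linear* if $P_v$ is proportional to $\ell_v^{\alpha}$, *length-monotone* if $\ell_v\ge\ell_w$ implies $P_v\ge P_w$, and *sub-linear* if $\ell_v\ge\ell_w$ implies $P_v/\ell_v^{\alpha}\le P_w/\ell_w^{\alpha}$. **Acknowledgements.** With *free or cheap* acknowledgements, each sender whose packet is received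 learns so, and a round takes $1+\varepsilon$ slots, where $0\le\varepsilon\le1$ ($\varepsilon=0$ means free). With *explicit* acknowledgements, a round consists of two slots: a data slot, and a slot in which exactly the receivers that have just received their packet send an acknowledgement back, subject to the SINR condition for the dual links (senders and receivers swapped). The acknowledgement packets use the same powers $P_v$ for uniform power and for bi-directional links, and for linear power the dual powers $P^*_v=\gamma\ell_v^{\alpha}/P_v$, with any $\gamma>0$ such that $N/P^*_v\le N/P_v$ for all $v$. **Algorithm.** An *ack-only* algorithm is a randomized algorithm, the same for all senders, in which the decision of a sender to transmit in a round depends only on a common rough estimate $\hat n$ of $n$, on the clock, and on the sender's own past transmissions and received acknowledgements. The ack-only algorithm *Distributed*, with a constant $c_3>0$, is as follows: in phases $k=0,1,2,\dots$, put $q=\frac1{4\cdot 2^k}$, and for $\lceil 8c_3\ln\hat n/q\rceil$ rounds transmit independently with probability $q$; stop as soon as an acknowledgement is received. **Theorem.** Distributed is an $O(\log n)$-approximation for SINR scheduling with high probability. Precisely: for all $\alpha>0$, $\beta\ge1$, $\kappa>0$, $\rho\ge1$ there are constants $c_3,C>0$ such that for all $N\ge 0$, all $n\ge2$, all links and powers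 as above, and all estimates with $n^{1/\rho}\le\hat n\le n^{\rho}$, if all senders run Distributed, then with probability at least $1-n^{-\kappa}$ every link has been successfully scheduled and acknowledged within $C\,T\log n$ slots, in each of the following cases: 1. uniform power, uni-directional links, explicit acknowledgements; 2. linear power, uni-directional links, explicit acknowledgements; 3. any length-monotone sub-linear power assignment, bi-directional links, explicit acknowledgements; 4. any length-monotone sub-linear power assignment, uni-directional or bi-directional links, free or cheap acknowledgements. -/

import Mathlib

open scoped ENNReal

noncomputable section

namespace SINR

/-! ### Links, powers, the SINR condition, the scheduling number -/

/-- A family of `n` links in a metric space: link `v` goes from the sender `s v` to the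
receiver `r v`, and has positive length. (The links are indexed, so that two links may share
end points or even coincide.) -/
structure LinkSet (X : Type*) [MetricSpace X] (n : ℕ) where
  s : Fin n → X
  r : Fin n → X
  length_pos : ∀ v, 0 < dist (s v) (r v)

namespace LinkSet

variable {X : Type*} [MetricSpace X] {n : ℕ}

/-- The length of link `v`. -/
def length (L : LinkSet X n) (v : Fin n) : ℝ := dist (L.s v) (L.r v)

/-- The dual links, along which acknowledgements travel: senders and receivers are swapped. -/
def dual (L : LinkSet X n) : LinkSet X n where
  s := L.r
  r := L.s
  length_pos v := by rw [dist_comm]; exact L.length_pos v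

end LinkSet

/-- Uni-directional or bi-directional links. -/
inductive LinkMode
  | uni
  | bi

variable {X : Type*} [MetricSpace X] {n : ℕ}

/-- The distance `d_{wv}` from link `w` to link `v`. -/
def linkDist (m : LinkMode) (L : LinkSet X n) (w v : Fin n) : ℝ :=
  match m with
  | .uni => dist (L.s w) (L.r v)
  | .bi => min (min (dist (L.s w) (L.r v)) (dist (L.s v) (L.r w)))
      (min (dist (L.s w) (L.s v)) (dist (L.r w) (L.r v)))

/-- The SINR condition for link `v` when exactly the links of `S` transmit:
`(P_v / ℓ_v ^ α) / (∑_{w ∈ S \ {v}} P_w / d_{wv} ^ α + N) ≥ β`, with the denominator multiplied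
out (so that it may vanish), and where a link at distance `0` causes infinite interference. -/
def SINRCondition (m : LinkMode) (α β N : ℝ) (L : LinkSet X n) (P : Fin n → ℝ)
    (S : Finset (Fin n)) (v : Fin n) : Prop :=
  (∀ w ∈ S.erase v, 0 < linkDist m L w v) ∧
    β * (∑ w ∈ S.erase v, P w / linkDist m L w v ^ α + N) ≤ P v / L.length v ^ α

/-- `S` is SINR-feasible: all its links can transmit successfully in the same slot. -/
def Feasible (m : LinkMode) (α β N : ℝ) (L : LinkSet X n) (P : Fin n → ℝ)
    (S : Finset (Fin n)) : Prop :=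
  ∀ v ∈ S, SINRCondition m α β N L P S v

/-- The scheduling number `T(L)`: the minimum size of a partition of the links into feasible
sets. -/
def schedulingNumber (m : LinkMode) (α β N : ℝ) (L : LinkSet X n) (P : Fin n → ℝ) : ℕ :=
  sInf {k : ℕ | ∃ p : Finpartition (Finset.univ : Finset (Fin n)),
    p.parts.card = k ∧ ∀ S ∈ p.parts, Feasible m α β N L P S}

/-- Longer links use at least as much power. -/
def LengthMonotone (L : LinkSet X n) (P : Fin n → ℝ) : Prop :=
  ∀ v w, L.length w ≤ L.length v → P w ≤ P v

/-- Longer links are received with at most as much power. -/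
def SubLinear (α : ℝ) (L : LinkSet X n) (P : Fin n → ℝ) : Prop :=
  ∀ v w, L.length w ≤ L.length v → P v / L.length v ^ α ≤ P w / L.length w ^ α

/-- All links use the same power. -/
def IsUniform (P : Fin n → ℝ) : Prop := ∃ p : ℝ, ∀ v, P v = p

/-- The power of a link is proportional to `ℓ_v ^ α`. -/
def IsLinear (α : ℝ) (L : LinkSet X n) (P : Fin n → ℝ) : Prop :=
  ∃ p : ℝ, ∀ v, P v = p * L.length v ^ α

/-- The dual power assignment `P*_v = γ ℓ_v ^ α / P_v`, used by the dual links. -/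
def dualPower (α γ : ℝ) (L : LinkSet X n) (P : Fin n → ℝ) (v : Fin n) : ℝ :=
  γ * L.length v ^ α / P v

/-! ### Which senders receive an acknowledgement -/

open Classical in
/-- The transmitting links whose packet is received when exactly the links of `S` transmit. -/
def received (m : LinkMode) (α β N : ℝ) (L : LinkSet X n) (P : Fin n → ℝ)
    (S : Finset (Fin n)) : Finset (Fin n) :=
  S.filter fun v => SINRCondition m α β N L P S v

/-- Acknowledgements that need not be realized: every sender whose packet is received
learns so. -/
def freeAck (m : LinkMode) (α β N : ℝ) (L : LinkSet X n) (P : Fin n → ℝ) :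
    Finset (Fin n) → Finset (Fin n) :=
  received m α β N L P

/-- Explicit acknowledgements: a round consists of a data slot and an acknowledgement slot.
Every receiver that has received its packet in the data slot transmits an acknowledgement, with
the power assignment `Pack`, in the acknowledgement slot, where these packets interfere with
each other in turn. -/
def explicitAck (m : LinkMode) (α β N : ℝ) (L : LinkSet X n) (P Pack : Fin n → ℝ)
    (S : Finset (Fin n)) : Finset (Fin n) :=
  received m α β N L.dual Pack (received m α β N L P S)

/-! ### Ack-only distributed algorithms and their executions -/

/-- What a sender has observed so far, most recent round first: whether it transmitted in the
round, and whether it received an acknowledgement. -/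
abbrev History := List (Bool × Bool)

/-- An ack-only algorithm, run by every sender: the probability of transmitting in the next round
depends only on the common estimate of the number of links, and on the sender's own history
(whose length is the number of rounds that have passed on the common clock). -/
structure AckOnlyAlgorithm where
  transmitProb : ℕ → History → unitInterval

/-- The random set of transmitting links, when link `v` transmits with probability `p v`,
independently of the others. -/
def transmitters (p : Fin n → unitInterval) : PMF (Finset (Fin n)) :=
  PMF.ofFintype
    (fun S => (∏ v ∈ S, ENNReal.ofReal (p v)) * ∏ v ∈ Sᶜ, ENNReal.ofReal (1 - p v)) (by
      have h := Finset.prod_add (fun v => ENNReal.ofReal (p v : ℝ))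
        (fun v => ENNReal.ofReal (1 - p v : ℝ)) (Finset.univ : Finset (Fin n))
      rw [Finset.powerset_univ] at h
      simp only [Finset.compl_eq_univ_sdiff]
      rw [← h]
      refine Finset.prod_eq_one fun v _ => ?_
      rw [← ENNReal.ofReal_add (p v).2.1 (by linarith [(p v).2.2])]
      simp)

/-- The law of the histories of all senders after `t` rounds, when all senders run `A` with
the estimate `nHat`. If `S` is the set of transmitting links in a round, then the senders of the
links in `ack S` receive an acknowledgement in that round. -/
def AckOnlyAlgorithm.run (A : AckOnlyAlgorithm) (nHat : ℕ)
    (ack : Finset (Fin n) → Finset (Fin n)) : ℕ → PMF (Fin n → History)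
  | 0 => PMF.pure fun _ => []
  | t + 1 => (AckOnlyAlgorithm.run A nHat ack t).bind fun H =>
      (transmitters fun v => A.transmitProb nHat (H v)).map fun S v =>
        (decide (v ∈ S), decide (v ∈ ack S)) :: H v

/-- The sender has received an acknowledgement. -/
def Acknowledged (h : History) : Prop := ∃ o ∈ h, o.2 = true

/-- When every round takes `cost` slots, all links have been scheduled (and their senders know it)
within `B` slots, with probability at least `1 - δ`. -/
def AckOnlyAlgorithm.SchedulesWithin (A : AckOnlyAlgorithm) (nHat : ℕ)
    (ack : Finset (Fin n) → Finset (Fin n)) (cost B δ : ℝ) : Prop :=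
  ∃ t : ℕ, cost * t ≤ B ∧
    ENNReal.ofReal (1 - δ) ≤ (A.run nHat ack t).toOuterMeasure {H | ∀ v, Acknowledged (H v)}

/-! ### The algorithm `Distributed` -/

/-- The transmission probability `q = 1 / (4 * 2 ^ k)` in phase `k`. -/
def phaseProb (k : ℕ) : ℝ := 1 / (4 * 2 ^ k)

/-- The number of rounds of phase `k`: `8 c₃ ln n / q`, rounded up. -/
def phaseLength (c₃ : ℝ) (nHat k : ℕ) : ℕ := ⌈8 * c₃ * Real.log nHat / phaseProb k⌉₊

/-- One iteration of the inner loop; the state is `(k, i)`, where `i` is the number of rounds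
of phase `k` that have passed. -/
def loopStep (c₃ : ℝ) (nHat : ℕ) (x : ℕ × ℕ) : ℕ × ℕ :=
  if x.2 + 1 < phaseLength c₃ nHat x.1 then (x.1, x.2 + 1) else (x.1 + 1, 0)

/-- The phase `k` after `t` rounds. -/
def phaseAt (c₃ : ℝ) (nHat t : ℕ) : ℕ := ((loopStep c₃ nHat)^[t] (0, 0)).1

lemma phaseProb_mem (k : ℕ) : phaseProb k ∈ unitInterval := by
  have h : (1 : ℝ) ≤ 2 ^ k := one_le_pow₀ (by norm_num)
  refine ⟨by unfold phaseProb; positivity, ?_⟩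
  unfold phaseProb
  rw [div_le_one (by positivity)]
  linarith

open Classical in
/-- The backoff algorithm: as long as no acknowledgement has arrived, transmit with the
probability of the current phase. -/
def distributed (c₃ : ℝ) : AckOnlyAlgorithm where
  transmitProb nHat h :=
    if Acknowledged h then 0
    else ⟨phaseProb (phaseAt c₃ nHat h.length), phaseProb_mem _⟩

end SINR

end

/-!
The affectance `a_w(v)` is the share of the interference tolerated by link `v` that `w` causes,
capped at `1`. In a feasible set `S` every link has in-affectance `∑_{w ∈ S} a_w(v)` at most `1`,
and a link fails only if its in-affectance is at least `1`.

The core is that in every set `R` of links, all but a small fraction have in-affectance `O(T)` from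
`R` on average (`exists_subset_sum_affectance_le`). Split `R` into `T` feasible classes. A class of
links that are no shorter than `v` has affectance `O(1)` on `v` (`sum_affectance_in_le`), and `v`
has affectance `O(1)` on those members of the class that have small affectance on the class
themselves (`sum_affectance_out_le`). Since the total out-affectance within a class equals the total
in-affectance, most links of the class are such members, and every pair of links is covered by one
of the two bounds, according to which link is longer. Both bounds replace `v` by a nearby link of
the class (`exists_surrogate`). The exceptional links, where this changes the distance by more than
a factor `3`, are all close to each other compared to their lengths, so that feasibility
limits their number.

When each link of `R` transmits with probability `q = c / T`, the expected affectance among the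
transmitting links is therefore small, except on a small fraction of them, and a constant
fraction of the transmissions succeeds. The acknowledgements lost are bounded by the affectance
among the links whose packet is received (`AckReliable`), since the dual affectance is at most a
constant times the affectance in either direction. So the expected number of links without
acknowledgement decreases by the factor `1 - q / 2` per round (`expectation_card_pending_le`). The
phase with `q ≈ c / T` has `Θ(log n / q)` rounds and, together with all earlier phases,
takes `O(T log n)` slots; Markov's inequality concludes.
-/

namespace SINR

/-! ### Affectance -/

/-- The ratio `min 1 (x / y)`, where the quotient counts as infinite if `y = 0 < x`. -/
noncomputable def cappedRatio (x y : ℝ) : ℝ := if y ≤ x then 1 else x / y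

lemma cappedRatio_nonneg {x y : ℝ} (hx : 0 < x) : 0 ≤ cappedRatio x y := by
  unfold cappedRatio
  split_ifs with h
  · exact zero_le_one
  · exact div_nonneg hx.le (hx.le.trans (not_le.1 h).le)

lemma cappedRatio_le_one {x y : ℝ} (hx : 0 < x) : cappedRatio x y ≤ 1 := by
  unfold cappedRatio
  split_ifs with h
  · exact le_rfl
  · rw [not_le] at h
    exact (div_le_one (hx.trans h)).2 h.le

lemma cappedRatio_le_mul {x y x' y' k : ℝ} (hx : 0 < x) (hy : 0 ≤ y) (hx' : 0 < x')
    (hk : 1 ≤ k) (h : x * y' ≤ k * (x' * y)) :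
    cappedRatio x y ≤ k * cappedRatio x' y' := by
  by_cases h' : y' ≤ x'
  · have : cappedRatio x' y' = 1 := by simp [cappedRatio, h']
    rw [this, mul_one]
    exact (cappedRatio_le_one hx).trans hk
  · have e : cappedRatio x' y' = x' / y' := by simp [cappedRatio, h']
    rw [not_le] at h'
    have hy' : 0 < y' := hx'.trans h'
    have hypos : 0 < y := by
      rcases hy.eq_or_lt with rfl | hy
      · nlinarith [mul_pos hx hy']
      · exact hy
    have h2 : x / y ≤ k * (x' / y') := by
      rw [← mul_div_assoc, div_le_div_iff₀ hypos hy']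
      linarith
    rw [e]
    unfold cappedRatio
    split_ifs with h3
    · exact ((one_le_div hypos).2 h3).trans h2
    · exact h2

lemma one_le_mul_cappedRatio {x y k : ℝ} (hx : 0 < x) (hk : 1 ≤ k) (h : y ≤ k * x) :
    1 ≤ k * cappedRatio x y := by
  have := cappedRatio_le_mul (x := 1) (y := 1) one_pos zero_le_one hx hk
    (y' := y) (by linarith)
  simpa [cappedRatio] using this

variable {X : Type*} [MetricSpace X] {n : ℕ}

/-- The interference that link `v` tolerates: it succeeds iff it receives at most this much. -/
noncomputable def slack (α β N : ℝ) (L : LinkSet X n) (P : Fin n → ℝ) (v : Fin n) : ℝ :=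
  P v / L.length v ^ α / β - N

/-- The affectance of link `w` on link `v`: the share of the interference tolerated by `v` that
`w` uses up, capped at `1`. -/
noncomputable def affectance (m : LinkMode) (α β N : ℝ) (L : LinkSet X n) (P : Fin n → ℝ)
    (w v : Fin n) : ℝ :=
  cappedRatio (P w) (linkDist m L w v ^ α * slack α β N L P v)

lemma linkDist_nonneg (m : LinkMode) (L : LinkSet X n) (w v : Fin n) : 0 ≤ linkDist m L w v := by
  cases m <;> simp [linkDist]

lemma linkDist_dual (m : LinkMode) (L : LinkSet X n) (w v : Fin n) :
    linkDist m L.dual w v = linkDist m L v w := by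
  cases m
  · simp [linkDist, LinkSet.dual, dist_comm]
  · simp only [linkDist, LinkSet.dual]
    rw [dist_comm (L.r w) (L.s v), dist_comm (L.r v) (L.s w), dist_comm (L.r w) (L.r v),
      dist_comm (L.s w) (L.s v), min_comm (dist (L.r v) (L.r w))]

lemma linkDist_bi_comm (L : LinkSet X n) (w v : Fin n) :
    linkDist .bi L w v = linkDist .bi L v w := by
  simp only [linkDist]
  rw [dist_comm (L.s w) (L.s v), dist_comm (L.r w) (L.r v), min_comm (dist (L.s w) (L.r v))]

lemma length_dual (L : LinkSet X n) (v : Fin n) : L.dual.length v = L.length v := dist_comm _ _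

variable {m : LinkMode} {α β N : ℝ} {L : LinkSet X n} {P : Fin n → ℝ}

lemma length_rpow_pos (L : LinkSet X n) (α : ℝ) (v : Fin n) : 0 < L.length v ^ α :=
  Real.rpow_pos_of_pos (L.length_pos v) _

lemma affectance_nonneg (hP : ∀ v, 0 < P v) (w v : Fin n) : 0 ≤ affectance m α β N L P w v :=
  cappedRatio_nonneg (hP w)

lemma affectance_le_one (hP : ∀ v, 0 < P v) (w v : Fin n) : affectance m α β N L P w v ≤ 1 :=
  cappedRatio_le_one (hP w)

lemma slack_le (hβ : 1 ≤ β) (hN : 0 ≤ N) (hP : ∀ v, 0 < P v) (v : Fin n) :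
    slack α β N L P v ≤ P v / L.length v ^ α := by
  have h : P v / L.length v ^ α / β ≤ P v / L.length v ^ α :=
    div_le_self (div_pos (hP v) (length_rpow_pos L α v)).le hβ
  unfold slack
  linarith

lemma slack_mul_length_le (hβ : 1 ≤ β) (hN : 0 ≤ N) (hP : ∀ v, 0 < P v) (v : Fin n) :
    L.length v ^ α * slack α β N L P v ≤ P v := by
  have := slack_le (α := α) (L := L) hβ hN hP v
  rwa [le_div_iff₀' (length_rpow_pos L α v)] at this

lemma slack_nonneg_of_feasible_singleton (hβ : 1 ≤ β) {v : Fin n}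
    (h : Feasible m α β N L P {v}) : 0 ≤ slack α β N L P v := by
  have := (h v (Finset.mem_singleton_self v)).2
  have hβ' : 0 < β := by linarith
  simp only [Finset.erase_singleton, Finset.sum_empty, zero_add] at this
  unfold slack
  rw [sub_nonneg, le_div_iff₀' hβ']
  exact this

lemma SINRCondition.sum_affectance_le_one (hβ : 1 ≤ β) (hP : ∀ v, 0 < P v)
    {S : Finset (Fin n)} {v : Fin n} (h : SINRCondition m α β N L P S v) :
    ∑ w ∈ S.erase v, affectance m α β N L P w v ≤ 1 := by
  have hβ' : 0 < β := by linarith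
  obtain ⟨hd, hs⟩ := h
  have hle : ∑ w ∈ S.erase v, P w / linkDist m L w v ^ α ≤ slack α β N L P v := by
    unfold slack
    rw [le_sub_iff_add_le, le_div_iff₀' hβ']
    exact hs
  have hpos : ∀ w ∈ S.erase v, 0 < linkDist m L w v ^ α :=
    fun w hw => Real.rpow_pos_of_pos (hd w hw) _
  rcases (S.erase v).eq_empty_or_nonempty with he | hne
  · simp [he]
  have hsl : 0 < slack α β N L P v :=
    (Finset.sum_pos (fun w hw => div_pos (hP w) (hpos w hw)) hne).trans_le hle
  calc ∑ w ∈ S.erase v, affectance m α β N L P w v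
      ≤ ∑ w ∈ S.erase v, P w / linkDist m L w v ^ α / slack α β N L P v := by
        refine Finset.sum_le_sum fun w hw => ?_
        rw [div_div]
        unfold affectance cappedRatio
        split_ifs with h
        · exact (one_le_div (mul_pos (hpos w hw) hsl)).2 h
        · exact le_rfl
    _ ≤ 1 := by
        rw [← Finset.sum_div]
        exact (div_le_one hsl).2 hle

/-- The converse of `SINRCondition.sum_affectance_le_one` up to the boundary case: as affectance is
capped at `1`, an affectance of exactly `1` decides nothing. -/
lemma one_le_sum_affectance (hα : 0 < α) (hβ : 1 ≤ β) (hP : ∀ v, 0 < P v)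
    {S : Finset (Fin n)} {v : Fin n} (hs : 0 ≤ slack α β N L P v)
    (h : ¬ SINRCondition m α β N L P S v) :
    1 ≤ ∑ w ∈ S.erase v, affectance m α β N L P w v := by
  have hβ' : 0 < β := by linarith
  by_contra! hlt
  refine h ?_
  have hlt1 : ∀ w ∈ S.erase v, affectance m α β N L P w v < 1 := fun w hw =>
    (Finset.single_le_sum (fun u _ => affectance_nonneg hP u v) hw).trans_lt hlt
  have hbr : ∀ w ∈ S.erase v, P w < linkDist m L w v ^ α * slack α β N L P v := by
    intro w hw
    by_contra! hc
    have := hlt1 w hw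
    simp [affectance, cappedRatio, hc] at this
  have hd : ∀ w ∈ S.erase v, 0 < linkDist m L w v := by
    intro w hw
    rcases (linkDist_nonneg m L w v).eq_or_lt with h0 | h0
    · have := hbr w hw
      rw [← h0, Real.zero_rpow hα.ne', zero_mul] at this
      exact absurd this (hP w).le.not_gt
    · exact h0
  refine ⟨hd, ?_⟩
  have key : ∑ w ∈ S.erase v, P w / linkDist m L w v ^ α ≤ slack α β N L P v := by
    have e : ∀ w ∈ S.erase v, P w / linkDist m L w v ^ α =
        slack α β N L P v * affectance m α β N L P w v := by
      intro w hw
      have h1 := Real.rpow_pos_of_pos (hd w hw) α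
      have h2 : 0 < slack α β N L P v := by
        by_contra! hc
        have := hbr w hw
        nlinarith [hP w]
      rw [affectance, cappedRatio, if_neg (not_le.2 (hbr w hw))]
      field_simp
    rw [Finset.sum_congr rfl e, ← Finset.mul_sum]
    exact mul_le_of_le_one_right hs hlt.le
  unfold slack at key
  rwa [le_sub_iff_add_le, le_div_iff₀' hβ'] at key

lemma SINRCondition.mono (hP : ∀ v, 0 < P v) (hβ : 1 ≤ β) {S S' : Finset (Fin n)}
    {v : Fin n} (hS : S' ⊆ S) (h : SINRCondition m α β N L P S v) :
    SINRCondition m α β N L P S' v := by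
  refine ⟨fun w hw => h.1 w (Finset.erase_subset_erase v hS hw), le_trans ?_ h.2⟩
  refine mul_le_mul_of_nonneg_left (add_le_add_left ?_ N) (by linarith)
  exact Finset.sum_le_sum_of_subset_of_nonneg (Finset.erase_subset_erase v hS)
    fun w _ _ => div_nonneg (hP w).le (Real.rpow_nonneg (linkDist_nonneg m L w v) _)

lemma Feasible.subset (hP : ∀ v, 0 < P v) (hβ : 1 ≤ β) {S S' : Finset (Fin n)}
    (hS : S' ⊆ S) (h : Feasible m α β N L P S) : Feasible m α β N L P S' :=
  fun v hv => (h v (hS hv)).mono hP hβ hS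

/-! ### Affectance between a link and a feasible set of longer links -/

/-- Among links that are no shorter than `v`, a link `w₁` closest to the sending end of `v` can
stand in for `v` as an interferer, except on links that are all close to `v`, and hence to each
other. -/
lemma exists_surrogate (m : LinkMode) (L : LinkSet X n) (v : Fin n) {S : Finset (Fin n)}
    (hne : S.Nonempty) (hS : ∀ w ∈ S, L.length v ≤ L.length w) :
    ∃ w₁ ∈ S, ∀ w ∈ S, 3 * linkDist m L v w < linkDist m L w₁ w →
      ∀ w' ∈ S, 3 * linkDist m L v w' < linkDist m L w₁ w' →
        linkDist m L w' w ≤ 3 * L.length w' := by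
  cases m
  · obtain ⟨w₁, hw₁, hmin⟩ := S.exists_min_image (fun w => dist (L.s v) (L.s w)) hne
    refine ⟨w₁, hw₁, fun w hw h w' hw' h' => ?_⟩
    simp only [linkDist, LinkSet.length] at *
    have h1 := dist_triangle_left (L.s w₁) (L.r w) (L.s v)
    have h1' := dist_triangle_left (L.s w₁) (L.r w') (L.s v)
    have h2 := dist_triangle_right (L.s v) (L.s w') (L.r w')
    have h3 := hmin w' hw'
    have h4 := dist_triangle4_right (L.s w') (L.r w) (L.r w') (L.s v)
    have h5 := dist_triangle_left (L.r w') (L.r w) (L.s v)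
    have h6 := dist_triangle (L.s w') (L.r w') (L.r w)
    linarith
  · obtain ⟨w₁, hw₁, hmin⟩ := S.exists_min_image (fun w => linkDist .bi L v w) hne
    -- The distance between links satisfies the triangle inequality up to the length of the
    -- middle link.
    have tri : ∀ a b, linkDist .bi L a b ≤
        linkDist .bi L v a + linkDist .bi L v b + L.length v := by
      intro a b
      let e : Fin n → Bool → X := fun u i => bif i then L.s u else L.r u
      have hle : ∀ u w i j, linkDist .bi L u w ≤ dist (e u i) (e w j) := by
        intro u w i j
        cases i <;> cases j <;> simp [linkDist, e, dist_comm]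
      have hex : ∀ w, ∃ i j, linkDist .bi L v w = dist (e v i) (e w j) := by
        intro w
        simp only [linkDist]
        rcases min_choice (min (dist (L.s v) (L.r w)) (dist (L.s w) (L.r v)))
          (min (dist (L.s v) (L.s w)) (dist (L.r v) (L.r w))) with h | h <;> rw [h]
        · rcases min_choice (dist (L.s v) (L.r w)) (dist (L.s w) (L.r v)) with h | h <;> rw [h]
          · exact ⟨true, false, rfl⟩
          · exact ⟨false, true, dist_comm _ _⟩
        · rcases min_choice (dist (L.s v) (L.s w)) (dist (L.r v) (L.r w)) with h | h <;> rw [h]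
          · exact ⟨true, true, rfl⟩
          · exact ⟨false, false, rfl⟩
      have hend : ∀ i j, dist (e v i) (e v j) ≤ L.length v := by
        intro i j
        cases i <;> cases j <;> simp [e, LinkSet.length, dist_comm]
      obtain ⟨i, j, ha⟩ := hex a
      obtain ⟨i', j', hb⟩ := hex b
      have h1 := dist_triangle4 (e a j) (e v i) (e v i') (e b j')
      have h2 := hend i i'
      rw [dist_comm] at ha
      have h3 := hle a b j j'
      linarith
    refine ⟨w₁, hw₁, fun w hw h w' hw' h' => ?_⟩
    have h1 := tri w₁ w
    have h1' := tri w₁ w'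
    have h2 := tri w' w
    have h3 := hmin w hw
    have h3' := hmin w' hw'
    have h4 := hS w' hw'
    linarith

/-- A sum of terms `f w ≤ 1` is bounded if `f w ≤ k * g w` outside a small set `Q` and the sum of `g`,
with the surrogate `w₁` itself left out, is bounded. -/
lemma sum_le_of_surrogate {ι : Type*} [DecidableEq ι] {S S' Q : Finset ι} {f g : ι → ℝ}
    {w₁ : ι} {k D : ℝ} (hk : 0 ≤ k) (hS' : S' ⊆ S)
    (hf : ∀ w ∈ S', f w ≤ 1) (hg : ∀ w, 0 ≤ g w)
    (h : ∀ w ∈ S', w ∉ Q → f w ≤ k * g w) (hQ : (Q.card : ℝ) ≤ 1 + k)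
    (hsum : ∑ w ∈ S.erase w₁, g w ≤ D) : ∑ w ∈ S', f w ≤ 2 + k + k * D := by
  have h1 : ∑ w ∈ S', f w ≤ ∑ w ∈ S'.erase w₁, f w + 1 := by
    by_cases hw : w₁ ∈ S'
    · rw [← Finset.sum_erase_add _ _ hw]
      linarith [hf w₁ hw]
    · rw [Finset.erase_eq_of_notMem hw]
      linarith
  have h2 : ∑ w ∈ S'.erase w₁, f w ≤
      ∑ w ∈ S'.erase w₁, (k * g w + if w ∈ Q then 1 else 0) := by
    refine Finset.sum_le_sum fun w hw => ?_
    have hw' := Finset.mem_of_mem_erase hw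
    split_ifs with hq
    · linarith [hf w hw', mul_nonneg hk (hg w)]
    · linarith [h w hw' hq]
  have h3 : ∑ w ∈ S'.erase w₁, g w ≤ D :=
    (Finset.sum_le_sum_of_subset_of_nonneg (Finset.erase_subset_erase _ hS')
      fun w _ _ => hg w).trans hsum
  have h4 : ∑ w ∈ S'.erase w₁, (if w ∈ Q then (1 : ℝ) else 0) ≤ Q.card := by
    rw [← Finset.sum_filter, Finset.sum_const, nsmul_eq_mul, mul_one]
    exact_mod_cast Finset.card_le_card fun w hw => (Finset.mem_filter.1 hw).2
  rw [Finset.sum_add_distrib, ← Finset.mul_sum] at h2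
  linarith [mul_le_mul_of_nonneg_left h3 hk]

/-- If the members of `Q` other than `w₀` have weight at least `1 / k`, and total weight at most `1`,
then `Q` is small. -/
lemma card_le_of_one_le_mul {ι : Type*} [DecidableEq ι] {S Q : Finset ι} {g : ι → ℝ} {w₀ : ι}
    {k : ℝ} (hk : 0 ≤ k) (hw₀ : w₀ ∈ Q) (hQ : Q ⊆ S) (hg : ∀ w, 0 ≤ g w)
    (h : ∀ w ∈ Q, w ≠ w₀ → 1 ≤ k * g w) (hsum : ∑ w ∈ S.erase w₀, g w ≤ 1) :
    (Q.card : ℝ) ≤ 1 + k := by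
  have h1 : ((Q.erase w₀).card : ℝ) ≤ ∑ w ∈ Q.erase w₀, k * g w := by
    rw [Finset.card_eq_sum_ones]
    push_cast
    exact Finset.sum_le_sum fun w hw =>
      h w (Finset.mem_of_mem_erase hw) (Finset.ne_of_mem_erase hw)
  have h2 : ∑ w ∈ Q.erase w₀, g w ≤ 1 :=
    (Finset.sum_le_sum_of_subset_of_nonneg (Finset.erase_subset_erase _ hQ)
      fun w _ _ => hg w).trans hsum
  have h3 : ((Q.erase w₀).card : ℝ) + 1 = Q.card := by
    exact_mod_cast Finset.card_erase_add_one hw₀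
  rw [← Finset.mul_sum] at h1
  nlinarith

lemma rpow_le_mul_rpow {x y : ℝ} (hα : 0 < α) (hx : 0 ≤ x) (hy : 0 ≤ y) (h : x ≤ 3 * y) :
    x ^ α ≤ 3 ^ α * y ^ α := by
  rw [← Real.mul_rpow (by norm_num) hy]
  exact Real.rpow_le_rpow hx h hα.le

lemma one_le_three_rpow (hα : 0 < α) : (1 : ℝ) ≤ 3 ^ α :=
  Real.one_le_rpow (by norm_num) hα.le

/-- A link `w'` at distance at most `3 l` from `w` affects `w` by a constant, if from distance `l`
it would use up everything that `w` tolerates. -/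
lemma one_le_mul_affectance (hα : 0 < α) (hP : ∀ v, 0 < P v)
    {w' w : Fin n} {l : ℝ} (hl : 0 ≤ l) (hd : linkDist m L w' w ≤ 3 * l)
    (hs : 0 ≤ slack α β N L P w) (h : l ^ α * slack α β N L P w ≤ P w') :
    1 ≤ 3 ^ α * affectance m α β N L P w' w := by
  refine one_le_mul_cappedRatio (hP w') (one_le_three_rpow hα) ?_
  have h1 := rpow_le_mul_rpow hα (linkDist_nonneg m L w' w) hl hd
  have h3 : (0 : ℝ) < 3 ^ α := by positivity
  calc _ ≤ 3 ^ α * l ^ α * slack α β N L P w := mul_le_mul_of_nonneg_right h1 hs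
    _ ≤ _ := by rw [mul_assoc]; exact mul_le_mul_of_nonneg_left h h3.le

/-- The affectance of a link on longer links of a feasible set is bounded, if the latter have
bounded affectance on the set. -/
lemma sum_affectance_out_le (hα : 0 < α) (hβ : 1 ≤ β) (hN : 0 ≤ N) (hP : ∀ v, 0 < P v)
    (hs : ∀ v, 0 ≤ slack α β N L P v) (hmono : LengthMonotone L P) (hsub : SubLinear α L P)
    {S S' : Finset (Fin n)} (hS : Feasible m α β N L P S) (hS' : S' ⊆ S) (v : Fin n)
    (hv : ∀ w ∈ S', L.length v ≤ L.length w) {D : ℝ} (hD : 0 ≤ D)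
    (hout : ∀ w ∈ S', ∑ u ∈ S.erase w, affectance m α β N L P w u ≤ D) :
    ∑ w ∈ S', affectance m α β N L P v w ≤ 2 + 3 ^ α + 3 ^ α * D := by
  have hk := one_le_three_rpow hα
  have hk0 : (0 : ℝ) ≤ 3 ^ α := by linarith
  rcases S'.eq_empty_or_nonempty with rfl | hne
  · simp only [Finset.sum_empty]
    positivity
  obtain ⟨w₁, hw₁, hsur⟩ := exists_surrogate m L v hne hv
  let Q := S'.filter fun w => 3 * linkDist m L v w < linkDist m L w₁ w
  have hQmem : ∀ w, w ∈ Q ↔ w ∈ S' ∧ 3 * linkDist m L v w < linkDist m L w₁ w := by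
    simp [Q]
  refine sum_le_of_surrogate (S := S) (Q := Q) (w₁ := w₁) hk0 hS'
    (fun w _ => affectance_le_one hP v w) (fun w => affectance_nonneg hP w₁ w) ?_ ?_
    (hout w₁ hw₁)
  · intro w hw hq
    have hd : linkDist m L w₁ w ≤ 3 * linkDist m L v w := by
      by_contra! hc
      exact hq ((hQmem w).2 ⟨hw, hc⟩)
    refine cappedRatio_le_mul (hP v)
      (mul_nonneg (Real.rpow_nonneg (linkDist_nonneg m L v w) _) (hs w)) (hP w₁) hk ?_
    have h1 := rpow_le_mul_rpow hα (linkDist_nonneg m L w₁ w) (linkDist_nonneg m L v w) hd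
    calc _ ≤ P w₁ * (3 ^ α * linkDist m L v w ^ α * slack α β N L P w) :=
          mul_le_mul (hmono w₁ v (hv w₁ hw₁)) (mul_le_mul_of_nonneg_right h1 (hs w))
            (mul_nonneg (Real.rpow_nonneg (linkDist_nonneg m L w₁ w) _) (hs w)) (hP w₁).le
      _ = _ := by ring
  · rcases Q.eq_empty_or_nonempty with he | hQne
    · rw [he]
      simp only [Finset.card_empty, Nat.cast_zero]
      linarith
    -- The longest link of `Q` is affected by all other links of `Q`.
    obtain ⟨w₀, hw₀, hmax⟩ := Q.exists_max_image (fun w => L.length w) hQne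
    have hw₀' := (hQmem w₀).1 hw₀
    refine card_le_of_one_le_mul (S := S) hk0 hw₀
      (fun w hw => hS' ((hQmem w).1 hw).1) (fun w => affectance_nonneg hP w w₀) ?_
      ((hS w₀ (hS' hw₀'.1)).sum_affectance_le_one hβ hP)
    intro w hw _
    have hw' := (hQmem w).1 hw
    refine one_le_mul_affectance hα hP (L.length_pos w).le
      (hsur w₀ hw₀'.1 hw₀'.2 w hw'.1 hw'.2) (hs w₀) ?_
    have h1 := (slack_le (α := α) hβ hN hP w₀).trans (hsub w₀ w (hmax w hw))
    rwa [le_div_iff₀' (length_rpow_pos L α w)] at h1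

/-- The affectance of a feasible set of longer links on a link is bounded. -/
lemma sum_affectance_in_le (hα : 0 < α) (hβ : 1 ≤ β) (hN : 0 ≤ N) (hP : ∀ v, 0 < P v)
    (hs : ∀ v, 0 ≤ slack α β N L P v) (hmono : LengthMonotone L P) (hsub : SubLinear α L P)
    {S : Finset (Fin n)} (hS : Feasible m α β N L P S) (v : Fin n)
    (hv : ∀ w ∈ S, L.length v ≤ L.length w) :
    ∑ w ∈ S, affectance m α β N L P w v ≤ 2 + 3 ^ α + 3 ^ α * 1 := by
  have hk := one_le_three_rpow hα
  have hk0 : (0 : ℝ) ≤ 3 ^ α := by linarith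
  rcases S.eq_empty_or_nonempty with rfl | hne
  · simp only [Finset.sum_empty]
    positivity
  obtain ⟨w₁, hw₁, hsur⟩ := exists_surrogate m L.dual v hne (by simpa only [length_dual] using hv)
  simp only [linkDist_dual, length_dual] at hsur
  let Q := S.filter fun w => 3 * linkDist m L w v < linkDist m L w w₁
  have hQmem : ∀ w, w ∈ Q ↔ w ∈ S ∧ 3 * linkDist m L w v < linkDist m L w w₁ := by
    simp [Q]
  refine sum_le_of_surrogate (S := S) (Q := Q) (w₁ := w₁) hk0 subset_rfl
    (fun w _ => affectance_le_one hP w v) (fun w => affectance_nonneg hP w w₁) ?_ ?_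
    ((hS w₁ hw₁).sum_affectance_le_one hβ hP)
  · intro w hw hq
    have hd : linkDist m L w w₁ ≤ 3 * linkDist m L w v := by
      by_contra! hc
      exact hq ((hQmem w).2 ⟨hw, hc⟩)
    refine cappedRatio_le_mul (hP w)
      (mul_nonneg (Real.rpow_nonneg (linkDist_nonneg m L w v) _) (hs v)) (hP w) hk ?_
    have h1 := rpow_le_mul_rpow hα (linkDist_nonneg m L w w₁) (linkDist_nonneg m L w v) hd
    have h2 : slack α β N L P w₁ ≤ slack α β N L P v := by
      unfold slack
      have := hsub w₁ v (hv w₁ hw₁)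
      gcongr
    calc _ ≤ P w * (3 ^ α * linkDist m L w v ^ α * slack α β N L P v) :=
          mul_le_mul_of_nonneg_left (mul_le_mul h1 h2 (hs w₁)
            (mul_nonneg hk0 (Real.rpow_nonneg (linkDist_nonneg m L w v) _))) (hP w).le
      _ = _ := by ring
  · rcases Q.eq_empty_or_nonempty with he | hQne
    · rw [he]
      simp only [Finset.card_empty, Nat.cast_zero]
      linarith
    -- The shortest link of `Q` is affected by all other links of `Q`.
    obtain ⟨w₀, hw₀, hmin⟩ := Q.exists_min_image (fun w => L.length w) hQne
    have hw₀' := (hQmem w₀).1 hw₀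
    refine card_le_of_one_le_mul (S := S) hk0 hw₀
      (fun w hw => ((hQmem w).1 hw).1) (fun w => affectance_nonneg hP w w₀) ?_
      ((hS w₀ hw₀'.1).sum_affectance_le_one hβ hP)
    intro w hw _
    have hw' := (hQmem w).1 hw
    exact one_le_mul_affectance hα hP (L.length_pos w₀).le
      (hsur w hw'.1 hw'.2 w₀ hw₀'.1 hw₀'.2) (hs w₀)
      ((slack_mul_length_le hβ hN hP w₀).trans (hmono w w₀ (hmin w hw)))

/-! ### Average affectance -/

lemma sum_erase_comm {ι : Type*} [DecidableEq ι] (S : Finset ι) (f : ι → ι → ℝ) :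
    ∑ w ∈ S, ∑ u ∈ S.erase w, f w u = ∑ w ∈ S, ∑ u ∈ S.erase w, f u w := by
  refine Finset.sum_comm' fun x y => ?_
  simp only [Finset.mem_erase]
  tauto

/-- In any set `R` of links, all but a fraction `η` of the links are affected by `O(T)` on
average, where `T` is the number of feasible classes. The good links are those of small
affectance on their own class: most links are good since, on average, the affectance of a link on
a feasible set containing it is the affectance of the set on the link, hence at most `1`. -/
lemma exists_subset_sum_affectance_le (hα : 0 < α) (hβ : 1 ≤ β) (hN : 0 ≤ N)
    (hP : ∀ v, 0 < P v) (hs : ∀ v, 0 ≤ slack α β N L P v) (hmono : LengthMonotone L P)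
    (hsub : SubLinear α L P) {ι : Type*} [DecidableEq ι] {t : Finset ι} {c : Fin n → ι}
    (hc : ∀ v, c v ∈ t) (hfeas : ∀ i ∈ t, Feasible m α β N L P {v | c v = i})
    (R : Finset (Fin n)) {η : ℝ} (hη : 0 < η) :
    ∃ M ⊆ R, ((R \ M).card : ℝ) ≤ η * R.card ∧
      ∑ w ∈ M, ∑ u ∈ R.erase w, affectance m α β N L P u w ≤
        (4 + 3 * 3 ^ α + 3 ^ α / η) * t.card * R.card := by
  let a := affectance m α β N L P
  have ha0 : ∀ u w, 0 ≤ a u w := fun u w => affectance_nonneg hP u w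
  let cl : ι → Finset (Fin n) := fun i => {v ∈ R | c v = i}
  have hcl : ∀ i ∈ t, Feasible m α β N L P (cl i) := fun i hi =>
    (hfeas i hi).subset hP hβ fun v hv => by simpa using (Finset.mem_filter.1 hv).2
  let M : Finset (Fin n) := {w ∈ R | ∑ u ∈ (cl (c w)).erase w, a w u ≤ 1 / η}
  have hMR : M ⊆ R := Finset.filter_subset _ _
  refine ⟨M, hMR, ?_, ?_⟩
  · have h1 : ∀ i ∈ t, ((({v ∈ R \ M | c v = i} : Finset (Fin n)).card : ℝ)) ≤
        η * (cl i).card := by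
      intro i hi
      calc ((({v ∈ R \ M | c v = i} : Finset (Fin n)).card : ℝ))
          ≤ ∑ w ∈ ({v ∈ R \ M | c v = i} : Finset (Fin n)),
              η * ∑ u ∈ (cl i).erase w, a w u := by
            rw [Finset.card_eq_sum_ones]
            push_cast
            refine Finset.sum_le_sum fun w hw => ?_
            obtain ⟨hw', rfl⟩ := Finset.mem_filter.1 hw
            obtain ⟨hwR, hwM⟩ := Finset.mem_sdiff.1 hw'
            have : 1 / η < ∑ u ∈ (cl (c w)).erase w, a w u := by
              by_contra! hcon
              exact hwM (Finset.mem_filter.2 ⟨hwR, hcon⟩)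
            exact ((div_lt_iff₀' hη).1 this).le
        _ ≤ ∑ w ∈ cl i, η * ∑ u ∈ (cl i).erase w, a w u := by
            refine Finset.sum_le_sum_of_subset_of_nonneg ?_
              fun w _ _ => mul_nonneg hη.le (Finset.sum_nonneg fun u _ => ha0 w u)
            exact Finset.filter_subset_filter _ Finset.sdiff_subset
        _ = η * ∑ w ∈ cl i, ∑ u ∈ (cl i).erase w, a u w := by
            rw [← Finset.mul_sum, sum_erase_comm]
        _ ≤ η * ∑ w ∈ cl i, 1 := by
            refine mul_le_mul_of_nonneg_left (Finset.sum_le_sum fun w hw => ?_) hη.le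
            exact (hcl i hi w hw).sum_affectance_le_one hβ hP
        _ = η * (cl i).card := by simp
    have h2 := Finset.sum_le_sum h1
    rw [← Finset.mul_sum] at h2
    have h3 := Finset.card_eq_sum_card_fiberwise (f := c) (s := R) (t := t) fun v _ => hc v
    have h4 := Finset.card_eq_sum_card_fiberwise (f := c) (s := R \ M) (t := t) fun v _ => hc v
    rw [h3, h4]
    push_cast
    exact h2
  · have hout : ∀ u, ∑ w ∈ M with L.length u ≤ L.length w, a u w ≤
        t.card * (2 + 3 ^ α + 3 ^ α * (1 / η)) := by
      intro u
      rw [← Finset.sum_fiberwise_of_maps_to (g := c) (t := t) fun v _ => hc v, ← nsmul_eq_mul,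
        ← Finset.sum_const]
      refine Finset.sum_le_sum fun i hi => ?_
      refine sum_affectance_out_le hα hβ hN hP hs hmono hsub (hcl i hi) ?_ u ?_
        (by positivity) ?_
      · intro w hw
        simp only [Finset.mem_filter] at hw
        exact Finset.mem_filter.2 ⟨hMR hw.1.1, hw.2⟩
      · intro w hw
        simp only [Finset.mem_filter] at hw
        exact hw.1.2
      · intro w hw
        simp only [Finset.mem_filter] at hw
        have := (Finset.mem_filter.1 hw.1.1).2
        rwa [hw.2] at this
    have hin : ∀ w, ∑ u ∈ R with L.length w ≤ L.length u, a u w ≤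
        t.card * (2 + 3 ^ α + 3 ^ α * 1) := by
      intro w
      rw [← Finset.sum_fiberwise_of_maps_to (g := c) (t := t) fun v _ => hc v, ← nsmul_eq_mul,
        ← Finset.sum_const]
      refine Finset.sum_le_sum fun i hi => ?_
      refine sum_affectance_in_le hα hβ hN hP hs hmono hsub ((hcl i hi).subset hP hβ ?_) w ?_
      · intro u hu
        simp only [Finset.mem_filter] at hu
        exact Finset.mem_filter.2 ⟨hu.1.1, hu.2⟩
      · intro u hu
        simp only [Finset.mem_filter] at hu
        exact hu.1.2
    calc ∑ w ∈ M, ∑ u ∈ R.erase w, a u w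
        ≤ ∑ w ∈ M, ∑ u ∈ R, a u w := by
          refine Finset.sum_le_sum fun w _ => ?_
          exact Finset.sum_le_sum_of_subset_of_nonneg (Finset.erase_subset _ _)
            fun u _ _ => ha0 u w
      _ ≤ ∑ w ∈ M, ∑ u ∈ R, ((if L.length w ≤ L.length u then a u w else 0) +
            if L.length u ≤ L.length w then a u w else 0) := by
          refine Finset.sum_le_sum fun w _ => Finset.sum_le_sum fun u _ => ?_
          have := ha0 u w
          rcases le_total (L.length w) (L.length u) with h | h <;> rw [if_pos h] <;>
            split_ifs <;> linarith
      _ = ∑ w ∈ M, ∑ u ∈ R with L.length w ≤ L.length u, a u w +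
            ∑ u ∈ R, ∑ w ∈ M with L.length u ≤ L.length w, a u w := by
          simp only [Finset.sum_add_distrib, Finset.sum_filter]
          rw [Finset.sum_comm (s := M) (t := R)
            (f := fun w u => if L.length u ≤ L.length w then a u w else 0)]
      _ ≤ M.card * (t.card * (2 + 3 ^ α + 3 ^ α * 1)) +
            R.card * (t.card * (2 + 3 ^ α + 3 ^ α * (1 / η))) := by
          simp only [← nsmul_eq_mul (M.card), ← nsmul_eq_mul (R.card), ← Finset.sum_const]
          exact add_le_add (Finset.sum_le_sum fun w _ => hin w)
            (Finset.sum_le_sum fun u _ => hout u)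
      _ ≤ R.card * (t.card * (2 + 3 ^ α + 3 ^ α * 1)) +
            R.card * (t.card * (2 + 3 ^ α + 3 ^ α * (1 / η))) := by
          have : (M.card : ℝ) ≤ R.card := by exact_mod_cast Finset.card_le_card hMR
          gcongr
      _ = _ := by ring

/-- An optimal schedule, given by the time slot `c v` of each link `v`. -/
lemma exists_schedule (hβ : 1 ≤ β) (hP : ∀ v, 0 < P v) (hfeas : ∀ v, Feasible m α β N L P {v}) :
    ∃ (t : Finset (Finset (Fin n))) (c : Fin n → Finset (Fin n)),
      t.card = schedulingNumber m α β N L P ∧ (∀ v, c v ∈ t) ∧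
      ∀ i ∈ t, Feasible m α β N L P {v | c v = i} := by
  have hne : {k : ℕ | ∃ p : Finpartition (Finset.univ : Finset (Fin n)),
      p.parts.card = k ∧ ∀ S ∈ p.parts, Feasible m α β N L P S}.Nonempty := by
    refine ⟨_, ⊥, rfl, fun S hS => ?_⟩
    obtain ⟨v, -, rfl⟩ := Finpartition.mem_bot_iff.1 hS
    exact hfeas v
  obtain ⟨p, hp, hpf⟩ := Nat.sInf_mem hne
  refine ⟨p.parts, p.part, hp, fun v => p.part_mem.2 (Finset.mem_univ v),
    fun i hi => (hpf i hi).subset hP hβ fun v hv => ?_⟩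
  rw [← (Finset.mem_filter.1 hv).2]
  exact p.mem_part (Finset.mem_univ v)

/-! ### The number of acknowledged links -/

/-- The acknowledgements `ack` reach all links whose packet is received, up to a number that is at
most `K` times the total affectance among these links. -/
def AckReliable (m : LinkMode) (α β N : ℝ) (L : LinkSet X n) (P : Fin n → ℝ) (K : ℝ)
    (ack : Finset (Fin n) → Finset (Fin n)) : Prop :=
  ∀ S, ack S ⊆ S ∧
    ((received m α β N L P S).card : ℝ) - K * ∑ w ∈ received m α β N L P S,
      ∑ u ∈ (received m α β N L P S).erase w, affectance m α β N L P u w ≤ (ack S).card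

lemma mem_received {S : Finset (Fin n)} {v : Fin n} :
    v ∈ received m α β N L P S ↔ v ∈ S ∧ SINRCondition m α β N L P S v := by
  simp [received]

lemma received_subset (S : Finset (Fin n)) : received m α β N L P S ⊆ S :=
  fun _ hv => (mem_received.1 hv).1

lemma ackReliable_freeAck (hP : ∀ v, 0 < P v) {K : ℝ} (hK : 0 ≤ K) :
    AckReliable m α β N L P K (freeAck m α β N L P) := by
  refine fun S => ⟨received_subset S, sub_le_self _ (mul_nonneg hK ?_)⟩
  exact Finset.sum_nonneg fun w _ => Finset.sum_nonneg fun u _ => affectance_nonneg hP u w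

/-- For bi-directional links, interference is symmetric, so that no acknowledgement of a received
packet is lost. -/
lemma explicitAck_bi (hP : ∀ v, 0 < P v) (hβ : 1 ≤ β) :
    explicitAck .bi α β N L P P = freeAck .bi α β N L P := by
  funext S
  have h : ∀ S v, SINRCondition .bi α β N L.dual P S v ↔ SINRCondition .bi α β N L P S v := by
    intro S v
    simp only [SINRCondition, linkDist_dual, length_dual, linkDist_bi_comm L v]
  ext v
  simp only [explicitAck, freeAck, mem_received, h]
  refine ⟨fun hv => hv.1, fun hv => ⟨hv, hv.2.mono hP hβ (received_subset S)⟩⟩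

/-- Explicit acknowledgements are reliable if the affectance among the dual links is bounded by the
affectance among the links themselves, in either direction. -/
lemma ackReliable_explicitAck (hα : 0 < α) (hβ : 1 ≤ β)
    {Pack : Fin n → ℝ} (hPack : ∀ v, 0 < Pack v) (hs : ∀ v, 0 ≤ slack α β N L.dual Pack v) {K : ℝ}
    (h : ∀ w v, affectance m α β N L.dual Pack w v ≤
      K * (affectance m α β N L P w v + affectance m α β N L P v w)) :
    AckReliable m α β N L P (2 * K) (explicitAck m α β N L P Pack) := by
  intro S
  refine ⟨(received_subset _).trans (received_subset _), ?_⟩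
  set Z := received m α β N L P S
  set A := explicitAck m α β N L P Pack S with hA
  have hAZ : A ⊆ Z := received_subset _
  have h1 : ((Z \ A).card : ℝ) ≤ ∑ w ∈ Z, ∑ u ∈ Z.erase w, affectance m α β N L.dual Pack u w := by
    calc ((Z \ A).card : ℝ)
        ≤ ∑ w ∈ Z \ A, ∑ u ∈ Z.erase w, affectance m α β N L.dual Pack u w := by
          rw [Finset.card_eq_sum_ones]
          push_cast
          refine Finset.sum_le_sum fun w hw => ?_
          obtain ⟨hwZ, hwA⟩ := Finset.mem_sdiff.1 hw
          exact one_le_sum_affectance hα hβ hPack (hs w)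
            fun hc => hwA (mem_received.2 ⟨hwZ, hc⟩)
      _ ≤ _ := Finset.sum_le_sum_of_subset_of_nonneg Finset.sdiff_subset
          fun w _ _ => Finset.sum_nonneg fun u _ => affectance_nonneg hPack u w
  have h2 : ∑ w ∈ Z, ∑ u ∈ Z.erase w, affectance m α β N L.dual Pack u w ≤
      ∑ w ∈ Z, ∑ u ∈ Z.erase w,
        K * (affectance m α β N L P u w + affectance m α β N L P w u) :=
    Finset.sum_le_sum fun w _ => Finset.sum_le_sum fun u _ => h u w
  simp only [← Finset.mul_sum, Finset.sum_add_distrib] at h2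
  rw [sum_erase_comm Z (affectance m α β N L P)] at h2
  have h3 : ((Z \ A).card : ℝ) = Z.card - A.card := Finset.cast_card_sdiff hAZ
  linarith

/-- For uniform power, the distances `d(s_w, r_v)` and `d(s_v, r_w)` are comparable, unless one of
the two links has the sender of the other within three times its length, and then it is affected by
a constant. -/
lemma affectance_dual_le_of_isUniform (hα : 0 < α) (hβ : 1 ≤ β) (hN : 0 ≤ N) (hP : ∀ v, 0 < P v)
    (hs : ∀ v, 0 ≤ slack α β N L P v) (h : IsUniform P) (w v : Fin n) :
    affectance .uni α β N L.dual P w v ≤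
      3 ^ α * (affectance .uni α β N L P w v + affectance .uni α β N L P v w) := by
  obtain ⟨p, hp⟩ := h
  have hk := one_le_three_rpow hα
  have h0 : ∀ u w, 0 ≤ 3 ^ α * affectance .uni α β N L P u w :=
    fun u w => mul_nonneg (by linarith) (affectance_nonneg hP u w)
  have hle := affectance_le_one (m := .uni) (α := α) (β := β) (N := N) (L := L.dual) hP w v
  have hnear : ∀ u w, linkDist .uni L u w ≤ 3 * L.length w →
      1 ≤ 3 ^ α * affectance .uni α β N L P u w := by
    intro u w hd
    refine one_le_mul_affectance hα hP (L.length_pos w).le hd (hs w) ?_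
    rw [hp u, ← hp w]
    exact slack_mul_length_le hβ hN hP w
  rw [mul_add]
  by_cases h1 : linkDist .uni L w v ≤ 3 * L.length v
  · linarith [hnear w v h1, h0 v w]
  by_cases h2 : linkDist .uni L v w ≤ 3 * L.length w
  · linarith [hnear v w h2, h0 w v]
  have hd : linkDist .uni L w v ≤ 3 * linkDist .uni L v w := by
    simp only [linkDist, LinkSet.length] at *
    have h3 := dist_triangle4 (L.s w) (L.r w) (L.s v) (L.r v)
    rw [dist_comm (L.r w)] at h3
    linarith [dist_nonneg (x := L.s v) (y := L.r w)]
  refine le_add_of_le_of_nonneg ?_ (h0 v w)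
  have hslack : slack α β N L.dual P v = slack α β N L P v := by
    simp only [slack, length_dual]
  unfold affectance
  rw [linkDist_dual, hslack]
  refine cappedRatio_le_mul (hP w) (mul_nonneg (Real.rpow_nonneg (linkDist_nonneg _ L v w) _)
    (hs v)) (hP w) hk ?_
  have h1 := rpow_le_mul_rpow hα (linkDist_nonneg _ L w v) (linkDist_nonneg _ L v w) hd
  calc _ ≤ P w * (3 ^ α * linkDist .uni L v w ^ α * slack α β N L P v) :=
        mul_le_mul_of_nonneg_left (mul_le_mul_of_nonneg_right h1 (hs v)) (hP w).le
    _ = _ := by ring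

lemma dualPower_pos {γ : ℝ} (hγ : 0 < γ) (hP : ∀ v, 0 < P v) (v : Fin n) :
    0 < dualPower α γ L P v :=
  div_pos (mul_pos hγ (length_rpow_pos L α v)) (hP v)

lemma slack_dual_nonneg (hβ : 1 ≤ β) (hP : ∀ v, 0 < P v)
    (hs : ∀ v, 0 ≤ slack α β N L P v) {γ : ℝ} (hγ : 0 < γ)
    (h : ∀ v, N / dualPower α γ L P v ≤ N / P v) (v : Fin n) :
    0 ≤ slack α β N L.dual (dualPower α γ L P) v := by
  have h1 := hs v
  have h2 := h v
  have hβ' : 0 < β := by linarith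
  have hl := length_rpow_pos L α v
  have hd := dualPower_pos (α := α) (L := L) hγ hP v
  simp only [slack, length_dual, sub_nonneg] at *
  rw [div_div, le_div_iff₀ (mul_pos hl hβ')] at *
  rw [div_le_div_iff₀ hd (hP v)] at h2
  have h3 : 0 ≤ dualPower α γ L P v := hd.le
  refine le_of_mul_le_mul_left ?_ (hP v)
  nlinarith [mul_le_mul_of_nonneg_right h2 (mul_pos hl hβ').le, mul_le_mul_of_nonneg_left h1 h3]

/-- For linear power, the dual power is uniform, and the affectance of a dual link is at most
the reverse affectance among the links themselves. -/
lemma affectance_dual_le_of_isLinear (hβ : 1 ≤ β) (hP : ∀ v, 0 < P v)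
    (hs : ∀ v, 0 ≤ slack α β N L P v) (hlin : IsLinear α L P) {γ : ℝ} (hγ : 0 < γ)
    (h : ∀ v, N / dualPower α γ L P v ≤ N / P v) (w v : Fin n) :
    affectance m α β N L.dual (dualPower α γ L P) w v ≤ affectance m α β N L P v w := by
  have hβ' : 0 < β := by linarith
  have hpos := dualPower_pos (α := α) (L := L) hγ hP
  have hsd := slack_dual_nonneg hβ hP hs hγ h v
  obtain ⟨p, hp⟩ := hlin
  have hl := length_rpow_pos L α
  have hp0 : 0 < p := pos_of_mul_pos_left (hp v ▸ hP v) (hl v).le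
  have hconst : ∀ u, dualPower α γ L P u = γ / p := by
    intro u
    have := (hl u).ne'
    rw [dualPower, hp u]
    field_simp
  rw [← one_mul (affectance m α β N L P v w)]
  unfold affectance
  rw [linkDist_dual]
  refine cappedRatio_le_mul (hpos w)
    (mul_nonneg (Real.rpow_nonneg (linkDist_nonneg _ L v w) _) hsd) (hP v) le_rfl ?_
  have hd := Real.rpow_nonneg (linkDist_nonneg m L v w) α
  have hN' : N * P v ≤ N * dualPower α γ L P v := by
    rw [← div_le_div_iff₀ (hpos v) (hP v)]
    exact h v
  have key : dualPower α γ L P w * slack α β N L P w ≤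
      P v * slack α β N L.dual (dualPower α γ L P) v := by
    have e1 : P w / L.length w ^ α = p := by rw [hp w, mul_div_cancel_right₀ _ (hl w).ne']
    have e2 : P v * (dualPower α γ L P v / L.length v ^ α / β) =
        p * dualPower α γ L P v / β := by
      have := (hl v).ne'
      nth_rewrite 1 [hp v]
      field_simp
    simp only [slack, length_dual]
    rw [e1, mul_sub, mul_sub, e2, hconst w, ← hconst v]
    have e3 : dualPower α γ L P v * (p / β) = p * dualPower α γ L P v / β := by ring
    linarith
  nlinarith [mul_le_mul_of_nonneg_left key hd]

/-- A lower bound for the number of acknowledged links which is a linear combination of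
indicators of links and of pairs of links, so that its expectation is easy to compute. -/
lemma AckReliable.le_card (hα : 0 < α) (hβ : 1 ≤ β) (hP : ∀ v, 0 < P v)
    (hs : ∀ v, 0 ≤ slack α β N L P v) {K : ℝ} (hK : 0 ≤ K)
    {ack : Finset (Fin n) → Finset (Fin n)} (h : AckReliable m α β N L P K ack)
    (S M : Finset (Fin n)) :
    ((S ∩ M).card : ℝ) - K * (S \ M).card -
      (K + 1) * ∑ w ∈ S ∩ M, ∑ u ∈ S.erase w, affectance m α β N L P u w ≤ (ack S).card := by
  refine le_trans ?_ (h S).2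
  let a := affectance m α β N L P
  have ha0 : ∀ u w, 0 ≤ a u w := fun u w => affectance_nonneg hP u w
  set Z := received m α β N L P S with hZ
  have hZS : Z ⊆ S := received_subset S
  -- The links of `S ∩ M` whose packet is lost are affected by at least `1`.
  have h1 : ((S ∩ M).card : ℝ) ≤ Z.card + ∑ w ∈ S ∩ M, ∑ u ∈ S.erase w, a u w := by
    have e : ((S ∩ M).card : ℝ) = ((S ∩ M) ∩ Z).card + ((S ∩ M) \ Z).card := by
      exact_mod_cast (Finset.card_inter_add_card_sdiff _ _).symm
    have e1 : (((S ∩ M) ∩ Z).card : ℝ) ≤ Z.card := by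
      exact_mod_cast Finset.card_le_card Finset.inter_subset_right
    have e2 : (((S ∩ M) \ Z).card : ℝ) ≤ ∑ w ∈ S ∩ M, ∑ u ∈ S.erase w, a u w := by
      calc (((S ∩ M) \ Z).card : ℝ) ≤ ∑ w ∈ (S ∩ M) \ Z, ∑ u ∈ S.erase w, a u w := by
            rw [Finset.card_eq_sum_ones]
            push_cast
            refine Finset.sum_le_sum fun w hw => ?_
            obtain ⟨hw, hwZ⟩ := Finset.mem_sdiff.1 hw
            exact one_le_sum_affectance hα hβ hP (hs w)
              fun hc => hwZ (mem_received.2 ⟨Finset.mem_of_mem_inter_left hw, hc⟩)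
        _ ≤ _ := Finset.sum_le_sum_of_subset_of_nonneg Finset.sdiff_subset
            fun w _ _ => Finset.sum_nonneg fun u _ => ha0 u w
    linarith
  -- A received link is affected by at most `1`, which is used for the links outside `M` only.
  have h2 : ∑ w ∈ Z, ∑ u ∈ Z.erase w, a u w ≤
      (S \ M).card + ∑ w ∈ S ∩ M, ∑ u ∈ S.erase w, a u w := by
    have hmono : ∀ w, ∑ u ∈ Z.erase w, a u w ≤ ∑ u ∈ S.erase w, a u w := fun w =>
      Finset.sum_le_sum_of_subset_of_nonneg (Finset.erase_subset_erase w hZS)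
        fun u _ _ => ha0 u w
    rw [← Finset.sum_inter_add_sum_sdiff Z M, add_comm]
    refine add_le_add ?_ ?_
    · calc ∑ w ∈ Z \ M, ∑ u ∈ Z.erase w, a u w ≤ ∑ w ∈ Z \ M, 1 := by
            refine Finset.sum_le_sum fun w hw => (hmono w).trans ?_
            exact (mem_received.1 (Finset.mem_sdiff.1 hw).1).2.sum_affectance_le_one hβ hP
        _ = (Z \ M).card := by simp
        _ ≤ _ := by exact_mod_cast Finset.card_le_card (Finset.sdiff_subset_sdiff hZS subset_rfl)
    · exact (Finset.sum_le_sum fun w _ => hmono w).trans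
        (Finset.sum_le_sum_of_subset_of_nonneg (Finset.inter_subset_inter hZS subset_rfl)
          fun w _ _ => Finset.sum_nonneg fun u _ => ha0 u w)
  linarith [mul_le_mul_of_nonneg_left h2 hK]

/-! ### Expectations -/

/-- The expectation of a nonnegative function under a discrete law. -/
noncomputable def expectation {γ : Type*} (μ : PMF γ) (f : γ → ℝ≥0∞) : ℝ≥0∞ := ∑' a, μ a * f a

lemma expectation_pure {γ : Type*} (a : γ) (f : γ → ℝ≥0∞) : expectation (PMF.pure a) f = f a := by
  unfold expectation
  rw [tsum_eq_single a fun b hb => by simp [PMF.pure_apply, hb]]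
  simp

lemma expectation_bind {γ δ : Type*} (μ : PMF γ) (g : γ → PMF δ) (f : δ → ℝ≥0∞) :
    expectation (μ.bind g) f = expectation μ fun a => expectation (g a) f := by
  simp only [expectation, PMF.bind_apply, ← ENNReal.tsum_mul_left, ← ENNReal.tsum_mul_right]
  rw [ENNReal.tsum_comm]
  simp only [mul_assoc]

lemma expectation_map {γ δ : Type*} (μ : PMF γ) (g : γ → δ) (f : δ → ℝ≥0∞) :
    expectation (μ.map g) f = expectation μ (f ∘ g) := by
  rw [← PMF.bind_pure_comp, expectation_bind]
  congr 1
  funext a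
  exact expectation_pure _ _

lemma expectation_mono {γ : Type*} {μ : PMF γ} {f g : γ → ℝ≥0∞}
    (h : ∀ a ∈ μ.support, f a ≤ g a) : expectation μ f ≤ expectation μ g := by
  refine ENNReal.tsum_le_tsum fun a => ?_
  by_cases ha : μ a = 0
  · simp [ha]
  · exact mul_le_mul_right (h a ((PMF.mem_support_iff _ _).2 ha)) _

lemma expectation_const_mul {γ : Type*} (μ : PMF γ) (r : ℝ≥0∞) (f : γ → ℝ≥0∞) :
    expectation μ (fun a => r * f a) = r * expectation μ f := by
  simp only [expectation, ← ENNReal.tsum_mul_left]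
  congr 1
  funext a
  ring

lemma expectation_const {γ : Type*} (μ : PMF γ) (r : ℝ≥0∞) :
    expectation μ (fun _ => r) = r := by
  simp [expectation, ENNReal.tsum_mul_right]

/-- Markov's inequality for a function that is at least `1` wherever it does not vanish. -/
lemma one_sub_le_toOuterMeasure {γ : Type*} (μ : PMF γ) {f : γ → ℝ≥0∞} {A : Set γ}
    (h : ∀ a ∉ A, 1 ≤ f a) {δ : ℝ≥0∞} (hδ : expectation μ f ≤ δ) :
    1 - δ ≤ μ.toOuterMeasure A := by
  classical
  rw [tsub_le_iff_right, ← μ.tsum_coe, PMF.toOuterMeasure_apply]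
  refine le_trans ?_ (add_le_add_right hδ _)
  unfold expectation
  rw [← ENNReal.tsum_add]
  refine ENNReal.tsum_le_tsum fun a => ?_
  by_cases ha : a ∈ A
  · simp [ha]
  · simpa [ha] using le_mul_of_one_le_right' (h a ha)

/-! ### The set of transmitting links -/

lemma transmitters_apply (p : Fin n → unitInterval) (S : Finset (Fin n)) :
    transmitters p S =
      ENNReal.ofReal ((∏ v ∈ S, (p v : ℝ)) * ∏ v ∈ Sᶜ, (1 - p v : ℝ)) := by
  unfold transmitters
  rw [PMF.ofFintype_apply, ENNReal.ofReal_mul (Finset.prod_nonneg fun v _ => (p v).2.1),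
    ENNReal.ofReal_prod_of_nonneg fun v _ => (p v).2.1,
    ENNReal.ofReal_prod_of_nonneg fun v _ => sub_nonneg.2 (p v).2.2]

/-- The probability that all links of `A` transmit. -/
lemma sum_prod_mul_prod_compl_of_subset (p : Fin n → ℝ) (A : Finset (Fin n)) :
    ∑ S : Finset (Fin n), ((∏ v ∈ S, p v) * ∏ v ∈ Sᶜ, (1 - p v)) * (if A ⊆ S then 1 else 0) =
      ∏ v ∈ A, p v := by
  have h := Finset.prod_add p (fun v => if v ∈ A then 0 else 1 - p v) Finset.univ
  rw [Finset.powerset_univ] at h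
  have h1 : ∏ v, (p v + if v ∈ A then 0 else 1 - p v) = ∏ v ∈ A, p v := by
    rw [← Finset.prod_subset (Finset.subset_univ A)]
    · exact Finset.prod_congr rfl fun v hv => by simp [hv]
    · intro v _ hv
      simp [hv]
  rw [← h1, h]
  refine Finset.sum_congr rfl fun S _ => ?_
  rw [← Finset.compl_eq_univ_sdiff]
  split_ifs with hA
  · rw [mul_one]
    congr 1
    refine Finset.prod_congr rfl fun v hv => ?_
    rw [if_neg fun hvA => Finset.mem_compl.1 hv (hA hvA)]
  · obtain ⟨v, hvA, hvS⟩ := Finset.not_subset.1 hA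
    rw [mul_zero, Finset.prod_eq_zero (i := v) (Finset.mem_compl.2 hvS) (by simp [hvA]), mul_zero]

/-- If the links of `R` transmit with probability `q`, and the number of links that succeed has a
lower bound by indicators of links and of pairs of links, then a fraction `q / 2` of the links of
`R` succeeds in expectation. -/
lemma sum_card_sdiff_le {R M : Finset (Fin n)} (hM : M ⊆ R) {p : Fin n → ℝ} {q : ℝ}
    (hq0 : 0 ≤ q) (hq1 : q ≤ 1) (hpR : ∀ v ∈ R, p v = q) (hpR' : ∀ v ∉ R, p v = 0)
    {a : Fin n → Fin n → ℝ} {K B : ℝ} (hK : 0 ≤ K)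
    (hRM : ((R \ M).card : ℝ) ≤ 1 / (4 * (K + 1)) * R.card)
    (ha : ∑ w ∈ M, ∑ u ∈ R.erase w, a u w ≤ B * R.card) (hB : (K + 1) * B * q ≤ 1 / 4)
    {ack : Finset (Fin n) → Finset (Fin n)} (hack : ∀ S, ack S ⊆ S)
    (h : ∀ S, ((S ∩ M).card : ℝ) - K * (S \ M).card -
      (K + 1) * ∑ w ∈ S ∩ M, ∑ u ∈ S.erase w, a u w ≤ (ack S).card) :
    ∑ S : Finset (Fin n), ((∏ v ∈ S, p v) * ∏ v ∈ Sᶜ, (1 - p v)) * ((R \ ack S).card : ℝ) ≤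
      (1 - q / 2) * R.card := by
  let W : Finset (Fin n) → ℝ := fun S => (∏ v ∈ S, p v) * ∏ v ∈ Sᶜ, (1 - p v)
  let I : Finset (Fin n) → Finset (Fin n) → ℝ := fun A S => if A ⊆ S then 1 else 0
  have hp : ∀ v, 0 ≤ p v ∧ p v ≤ 1 := by
    intro v
    by_cases hv : v ∈ R
    · rw [hpR v hv]
      exact ⟨hq0, hq1⟩
    · simp [hpR' v hv]
  have hW0 : ∀ S, 0 ≤ W S := fun S =>
    mul_nonneg (Finset.prod_nonneg fun v _ => (hp v).1)
      (Finset.prod_nonneg fun v _ => sub_nonneg.2 (hp v).2)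
  have hW : ∀ A, ∑ S, W S * I A S = ∏ v ∈ A, p v := sum_prod_mul_prod_compl_of_subset p
  have hW1 : ∑ S, W S = 1 := by simpa [I] using hW ∅
  have hWv : ∀ v ∈ R, ∑ S, W S * I {v} S = q := by
    intro v hv
    rw [hW, Finset.prod_singleton, hpR v hv]
  have hWuv : ∀ w ∈ R, ∀ u ∈ R.erase w, ∑ S, W S * I {u, w} S = q * q := by
    intro w hw u hu
    rw [hW, Finset.prod_pair (Finset.ne_of_mem_erase hu), hpR w hw,
      hpR u (Finset.mem_of_mem_erase hu)]
  let F : Finset (Fin n) → ℝ := fun S => R.card - ∑ v ∈ M, I {v} S + K * ∑ v ∈ R \ M, I {v} S +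
    (K + 1) * ∑ w ∈ M, ∑ u ∈ R.erase w, a u w * I {u, w} S
  have hle : ∀ S, W S * ((R \ ack S).card : ℝ) ≤ W S * F S := by
    intro S
    by_cases hSR : S ⊆ R
    · refine mul_le_mul_of_nonneg_left ?_ (hW0 S)
      have h1 : ((R \ ack S).card : ℝ) = R.card - (ack S).card :=
        Finset.cast_card_sdiff ((hack S).trans hSR)
      have h2 : ∑ v ∈ M, I {v} S = (S ∩ M).card := by
        simp only [I, Finset.singleton_subset_iff]
        rw [← Finset.sum_filter, Finset.sum_const, nsmul_eq_mul, mul_one,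
          Finset.filter_mem_eq_inter, Finset.inter_comm]
      have h3 : ∑ v ∈ R \ M, I {v} S = (S \ M).card := by
        simp only [I, Finset.singleton_subset_iff]
        rw [← Finset.sum_filter, Finset.sum_const, nsmul_eq_mul, mul_one]
        congr 2
        ext v
        simp only [Finset.mem_filter, Finset.mem_sdiff]
        exact ⟨fun hv => ⟨hv.2, hv.1.2⟩, fun hv => ⟨⟨hSR hv.1, hv.2⟩, hv.1⟩⟩
      have h4 : ∑ w ∈ M, ∑ u ∈ R.erase w, a u w * I {u, w} S =
          ∑ w ∈ S ∩ M, ∑ u ∈ S.erase w, a u w := by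
        rw [Finset.inter_comm, ← Finset.filter_mem_eq_inter, Finset.sum_filter]
        refine Finset.sum_congr rfl fun w _ => ?_
        split_ifs with hw
        · rw [← Finset.sum_subset (Finset.erase_subset_erase w hSR)]
          · refine Finset.sum_congr rfl fun u hu => ?_
            simp [I, Finset.insert_subset_iff, hw, Finset.mem_of_mem_erase hu]
          · intro u hu hu'
            have : u ∉ S := fun hc => hu' (Finset.mem_erase.2 ⟨Finset.ne_of_mem_erase hu, hc⟩)
            simp [I, Finset.insert_subset_iff, this]
        · exact Finset.sum_eq_zero fun u _ => by simp [I, Finset.insert_subset_iff, hw]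
      have h5 := h S
      simp only [F]
      rw [h1, h2, h3, h4]
      linarith
    · obtain ⟨v, hvS, hvR⟩ := Finset.not_subset.1 hSR
      have : W S = 0 := by
        simp only [W]
        rw [Finset.prod_eq_zero hvS (hpR' v hvR), zero_mul]
      simp [this]
  have hF : ∑ S, W S * F S = R.card - M.card * q + K * ((R \ M).card * q) +
      (K + 1) * ((∑ w ∈ M, ∑ u ∈ R.erase w, a u w) * (q * q)) := by
    have e1 : ∀ s ⊆ R, ∑ S, W S * ∑ v ∈ s, I {v} S = s.card * q := by
      intro s hs
      simp only [Finset.mul_sum]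
      rw [Finset.sum_comm, Finset.sum_congr rfl fun v hv => hWv v (hs hv)]
      simp
    have e2 : ∑ S, W S * ∑ w ∈ M, ∑ u ∈ R.erase w, a u w * I {u, w} S =
        (∑ w ∈ M, ∑ u ∈ R.erase w, a u w) * (q * q) := by
      simp only [Finset.mul_sum, Finset.sum_mul]
      rw [Finset.sum_comm]
      refine Finset.sum_congr rfl fun w hw => ?_
      rw [Finset.sum_comm]
      refine Finset.sum_congr rfl fun u hu => ?_
      simp only [mul_left_comm _ (a u w)]
      rw [← Finset.mul_sum, hWuv w (hM hw) u hu]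
    have e3 : ∀ S, W S * F S = W S * R.card - W S * ∑ v ∈ M, I {v} S +
        K * (W S * ∑ v ∈ R \ M, I {v} S) +
        (K + 1) * (W S * ∑ w ∈ M, ∑ u ∈ R.erase w, a u w * I {u, w} S) := fun S => by
      simp only [F]
      ring
    simp only [e3]
    rw [Finset.sum_add_distrib, Finset.sum_add_distrib, Finset.sum_sub_distrib, ← Finset.mul_sum,
      ← Finset.mul_sum, ← Finset.sum_mul, hW1, e1 M hM, e1 _ Finset.sdiff_subset, e2, one_mul]
  refine (Finset.sum_le_sum fun S _ => hle S).trans ?_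
  rw [hF]
  have hc : (M.card : ℝ) = R.card - (R \ M).card := by
    rw [Finset.cast_card_sdiff hM]
    ring
  have hRc : (0 : ℝ) ≤ R.card := Nat.cast_nonneg _
  have h1 : (K + 1) * ((R \ M).card : ℝ) ≤ R.card / 4 := by
    have := mul_le_mul_of_nonneg_left hRM (by linarith : 0 ≤ K + 1)
    refine this.trans (le_of_eq ?_)
    have : K + 1 ≠ 0 := by linarith
    field_simp
  have h2 : (K + 1) * (∑ w ∈ M, ∑ u ∈ R.erase w, a u w) * q ≤ R.card / 4 := by
    have e1 := mul_le_mul_of_nonneg_left ha (mul_nonneg (by linarith : 0 ≤ K + 1) hq0)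
    have e2 := mul_le_mul_of_nonneg_right hB hRc
    nlinarith
  have h3 := mul_le_mul_of_nonneg_left h1 hq0
  have h4 := mul_le_mul_of_nonneg_left h2 hq0
  rw [hc]
  nlinarith

/-! ### The clock of the algorithm -/

lemma phaseProb_pos (k : ℕ) : 0 < phaseProb k := by
  unfold phaseProb
  positivity

lemma phaseLength_pos {c₃ : ℝ} (hc : 0 < c₃) {nHat : ℕ} (hn : 2 ≤ nHat) (k : ℕ) :
    0 < phaseLength c₃ nHat k := by
  have : 0 < Real.log nHat := Real.log_pos (by exact_mod_cast hn)
  exact Nat.ceil_pos.2 (div_pos (by positivity) (phaseProb_pos k))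

lemma loopStep_iterate {c₃ : ℝ} {nHat : ℕ} (hlen : ∀ k, 0 < phaseLength c₃ nHat k) (k : ℕ) :
    ∀ i < phaseLength c₃ nHat k,
      (loopStep c₃ nHat)^[∑ j ∈ Finset.range k, phaseLength c₃ nHat j + i] (0, 0) = (k, i) := by
  have hin : ∀ k, (loopStep c₃ nHat)^[∑ j ∈ Finset.range k, phaseLength c₃ nHat j] (0, 0) =
      (k, 0) → ∀ i < phaseLength c₃ nHat k,
      (loopStep c₃ nHat)^[∑ j ∈ Finset.range k, phaseLength c₃ nHat j + i] (0, 0) = (k, i) := by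
    intro k h0 i
    induction i with
    | zero => exact fun _ => h0
    | succ i ih =>
      intro hi
      rw [← add_assoc, Function.iterate_succ_apply', ih (by omega)]
      simp [loopStep, hi]
  suffices h : (loopStep c₃ nHat)^[∑ j ∈ Finset.range k, phaseLength c₃ nHat j] (0, 0) = (k, 0)
    from hin k h
  induction k with
  | zero => rfl
  | succ k ih =>
    obtain ⟨l, hl⟩ : ∃ l, phaseLength c₃ nHat k = l + 1 :=
      ⟨phaseLength c₃ nHat k - 1, by have := hlen k; omega⟩
    rw [Finset.sum_range_succ, hl, ← add_assoc, Function.iterate_succ_apply',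
      hin k ih l (by omega)]
    simp [loopStep, hl]

lemma phaseAt_eq {c₃ : ℝ} {nHat : ℕ} (hlen : ∀ k, 0 < phaseLength c₃ nHat k) {k i : ℕ}
    (hi : i < phaseLength c₃ nHat k) :
    phaseAt c₃ nHat (∑ j ∈ Finset.range k, phaseLength c₃ nHat j + i) = k := by
  rw [phaseAt, loopStep_iterate hlen k i hi]

/-- The phases before phase `k` take `O(2 ^ k log nHat)` rounds. -/
lemma sum_phaseLength_le {c₃ : ℝ} (hc : 0 < c₃) (nHat k : ℕ) :
    ((∑ j ∈ Finset.range k, phaseLength c₃ nHat j : ℕ) : ℝ) ≤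
      (32 * c₃ * Real.log nHat + 1) * 2 ^ k := by
  have hlog : 0 ≤ Real.log nHat := Real.log_natCast_nonneg nHat
  induction k with
  | zero =>
    simp only [Finset.range_zero, Finset.sum_empty, Nat.cast_zero]
    positivity
  | succ k ih =>
    rw [Finset.sum_range_succ, Nat.cast_add]
    have h1 : (phaseLength c₃ nHat k : ℝ) ≤ 8 * c₃ * Real.log nHat / phaseProb k + 1 :=
      (Nat.ceil_lt_add_one (div_nonneg (by positivity) (phaseProb_pos k).le)).le
    have h2 : 8 * c₃ * Real.log nHat / phaseProb k = 32 * c₃ * Real.log nHat * 2 ^ k := by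
      unfold phaseProb
      field_simp
      ring
    have h3 : (1 : ℝ) ≤ 2 ^ k := one_le_pow₀ (by norm_num)
    rw [h2] at h1
    rw [pow_succ]
    linarith

/-! ### The number of links without acknowledgement -/

open Classical in
/-- The links without an acknowledgement so far. -/
noncomputable def pending (H : Fin n → History) : Finset (Fin n) :=
  {v | ¬ Acknowledged (H v)}

lemma length_of_mem_support_run {A : AckOnlyAlgorithm} {nHat : ℕ}
    {ack : Finset (Fin n) → Finset (Fin n)} {t : ℕ} {H : Fin n → History}
    (hH : H ∈ (A.run nHat ack t).support) (v : Fin n) : (H v).length = t := by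
  induction t generalizing H with
  | zero =>
    rw [AckOnlyAlgorithm.run, PMF.support_pure, Set.mem_singleton_iff] at hH
    simp [hH]
  | succ t ih =>
    rw [AckOnlyAlgorithm.run, PMF.mem_support_bind_iff] at hH
    obtain ⟨H', hH', hH⟩ := hH
    rw [PMF.mem_support_map_iff] at hH
    obtain ⟨S, -, rfl⟩ := hH
    simp [ih hH']

lemma pending_cons (H : Fin n → History) (S A : Finset (Fin n)) :
    pending (fun v => (decide (v ∈ S), decide (v ∈ A)) :: H v) = pending H \ A := by
  ext v
  simp [pending, Acknowledged]
  tauto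

lemma expectation_run_succ_le {A : AckOnlyAlgorithm} {nHat : ℕ}
    {ack : Finset (Fin n) → Finset (Fin n)} {t : ℕ} {r : ℝ≥0∞}
    (h : ∀ H : Fin n → History, (∀ v, (H v).length = t) →
      expectation (transmitters fun v => A.transmitProb nHat (H v))
        (fun S => ((pending H \ ack S).card : ℝ≥0∞)) ≤ r * (pending H).card) :
    expectation (A.run nHat ack (t + 1)) (fun H => ((pending H).card : ℝ≥0∞)) ≤
      r * expectation (A.run nHat ack t) (fun H => ((pending H).card : ℝ≥0∞)) := by
  rw [AckOnlyAlgorithm.run, expectation_bind, ← expectation_const_mul]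
  refine expectation_mono fun H hH => ?_
  rw [expectation_map]
  simpa only [Function.comp_def, pending_cons] using h H (length_of_mem_support_run hH)

lemma expectation_run_succ_le_self {A : AckOnlyAlgorithm} {nHat : ℕ}
    {ack : Finset (Fin n) → Finset (Fin n)} {t : ℕ} :
    expectation (A.run nHat ack (t + 1)) (fun H => ((pending H).card : ℝ≥0∞)) ≤
      expectation (A.run nHat ack t) (fun H => ((pending H).card : ℝ≥0∞)) := by
  rw [← one_mul (expectation (A.run nHat ack t) _)]
  refine expectation_run_succ_le fun H _ => ?_
  rw [one_mul, ← expectation_const (transmitters fun v => A.transmitProb nHat (H v))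
    ((pending H).card : ℝ≥0∞)]
  refine expectation_mono fun S _ => ?_
  exact_mod_cast Finset.card_le_card Finset.sdiff_subset

/-- If the expected number of pending links decreases by a factor `r` in each of `l` rounds from round
`t₀` on, it is at most `r ^ l * n` afterwards; earlier rounds do no harm. -/
lemma expectation_run_le {A : AckOnlyAlgorithm} {nHat : ℕ}
    {ack : Finset (Fin n) → Finset (Fin n)} {t₀ : ℕ} {r : ℝ≥0∞} :
    ∀ l : ℕ, (∀ i < l, ∀ H : Fin n → History, (∀ v, (H v).length = t₀ + i) →
      expectation (transmitters fun v => A.transmitProb nHat (H v))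
        (fun S => ((pending H \ ack S).card : ℝ≥0∞)) ≤ r * (pending H).card) →
    expectation (A.run nHat ack (t₀ + l)) (fun H => ((pending H).card : ℝ≥0∞)) ≤ r ^ l * n
  | 0, _ => by
    rw [pow_zero, one_mul, add_zero]
    clear * -
    induction t₀ with
    | zero =>
      rw [AckOnlyAlgorithm.run, expectation_pure]
      exact_mod_cast card_finset_fin_le _
    | succ t ih => exact expectation_run_succ_le_self.trans ih
  | l + 1, h => by
    refine (expectation_run_succ_le (h l l.lt_succ_self)).trans ?_
    rw [pow_succ', mul_assoc]
    exact mul_le_mul_right (expectation_run_le l fun i hi => h i (hi.trans l.lt_succ_self)) _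

/-- In a phase of transmission probability `O(1 / T)`, the expected number of links without
acknowledgement decreases by a fraction `q / 2` in every round. -/
lemma expectation_card_pending_le (hα : 0 < α) (hβ : 1 ≤ β) (hN : 0 ≤ N) (hP : ∀ v, 0 < P v)
    (hfeas : ∀ v, Feasible m α β N L P {v}) (hmono : LengthMonotone L P) (hsub : SubLinear α L P)
    {K : ℝ} (hK : 0 ≤ K) {ack : Finset (Fin n) → Finset (Fin n)}
    (hack : AckReliable m α β N L P K ack) (c₃ : ℝ) (nHat : ℕ) {H : Fin n → History} {t : ℕ}
    (hH : ∀ v, (H v).length = t)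
    (hq : (K + 1) * ((4 + 3 * 3 ^ α + 3 ^ α * (4 * (K + 1))) * schedulingNumber m α β N L P) *
      phaseProb (phaseAt c₃ nHat t) ≤ 1 / 4) :
    expectation (transmitters fun v => (distributed c₃).transmitProb nHat (H v))
        (fun S => ((pending H \ ack S).card : ℝ≥0∞)) ≤
      ENNReal.ofReal (1 - phaseProb (phaseAt c₃ nHat t) / 2) * (pending H).card := by
  have hs : ∀ v, 0 ≤ slack α β N L P v := fun v => slack_nonneg_of_feasible_singleton hβ (hfeas v)
  obtain ⟨T, c, hT, hc, hfe⟩ := exists_schedule hβ hP hfeas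
  have hη : 0 < 1 / (4 * (K + 1)) := by positivity
  obtain ⟨M, hMR, hcard, hsum⟩ := exists_subset_sum_affectance_le hα hβ hN hP hs hmono hsub hc hfe
    (pending H) hη
  rw [hT, div_div_eq_mul_div, div_one] at hsum
  have hmem := phaseProb_mem (phaseAt c₃ nHat t)
  have key := sum_card_sdiff_le hMR
    (p := fun v => ((distributed c₃).transmitProb nHat (H v) : ℝ)) hmem.1 hmem.2 ?_ ?_ hK hcard
    hsum hq (fun S => (hack S).1) (fun S => hack.le_card hα hβ hP hs hK S M)
  · have hpos : 0 ≤ 1 - phaseProb (phaseAt c₃ nHat t) / 2 := by linarith [hmem.1, hmem.2]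
    have := ENNReal.ofReal_le_ofReal key
    rw [ENNReal.ofReal_mul hpos, ENNReal.ofReal_natCast] at this
    refine le_trans (le_of_eq ?_) this
    rw [expectation, tsum_fintype, ENNReal.ofReal_sum_of_nonneg]
    · refine Finset.sum_congr rfl fun S _ => ?_
      rw [transmitters_apply, ENNReal.ofReal_mul' (Nat.cast_nonneg _), ENNReal.ofReal_natCast]
    · exact fun S _ => mul_nonneg (mul_nonneg (Finset.prod_nonneg fun v _ => unitInterval.nonneg _)
        (Finset.prod_nonneg fun v _ => unitInterval.one_minus_nonneg _)) (Nat.cast_nonneg _)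
  · intro v hv
    have hv' : ¬ Acknowledged (H v) := by simpa [pending] using hv
    simp [distributed, hv', hH]
  · intro v hv
    have hv' : Acknowledged (H v) := by simpa [pending] using hv
    simp [distributed, hv']

/-- The factor in front of `T log n` in the bound on the number of slots. -/
noncomputable def slotFactor (c₃ α ρ K : ℝ) : ℝ :=
  2 * (32 * c₃ * ρ + 2) * (4 * (K + 1) * (4 + 3 * 3 ^ α + 3 ^ α * (4 * (K + 1))))

/-- With reliable acknowledgements, `distributed` schedules all links in `O(T log n)` slots with high
probability: the phase with transmission probability `Θ(1 / T)` suffices. -/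
lemma schedulesWithin_of_ackReliable {κ ρ : ℝ} (hα : 0 < α) (hβ : 1 ≤ β) (hκ : 0 < κ)
    (hρ : 1 ≤ ρ) (hN : 0 ≤ N) (hn : 2 ≤ n) (hP : ∀ v, 0 < P v)
    (hfeas : ∀ v, Feasible m α β N L P {v}) (hmono : LengthMonotone L P) (hsub : SubLinear α L P)
    {nHat : ℕ} (hn₁ : (n : ℝ) ^ (1 / ρ) ≤ nHat) (hn₂ : (nHat : ℝ) ≤ (n : ℝ) ^ ρ)
    {K : ℝ} (hK : 0 ≤ K) {ack : Finset (Fin n) → Finset (Fin n)}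
    (hack : AckReliable m α β N L P K ack) {cost : ℝ} (hcost : cost ≤ 2) :
    (distributed (ρ * (1 + κ) / 4)).SchedulesWithin nHat ack cost
      (slotFactor (ρ * (1 + κ) / 4) α ρ K * Real.log n * schedulingNumber m α β N L P)
      ((n : ℝ) ^ (-κ)) := by
  set c₃ := ρ * (1 + κ) / 4 with hc₃
  have hc : 0 < c₃ := by positivity
  have hn0 : (0 : ℝ) < n := by positivity
  have hn1 : (1 : ℝ) < n := by exact_mod_cast hn
  have hnHat : 2 ≤ nHat := by
    have : (1 : ℝ) < nHat := (Real.one_lt_rpow hn1 (by positivity)).trans_le hn₁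
    exact_mod_cast this
  have hnHat0 : (0 : ℝ) < nHat := by positivity
  have hlen := phaseLength_pos hc hnHat
  set T := schedulingNumber m α β N L P with hT
  have hT1 : (1 : ℝ) ≤ T := by
    obtain ⟨t, c, ht, hct, -⟩ := exists_schedule hβ hP hfeas
    rw [hT, ← ht]
    exact_mod_cast Finset.card_pos.2 ⟨_, hct ⟨0, by omega⟩⟩
  set B := 4 + 3 * 3 ^ α + 3 ^ α * (4 * (K + 1)) with hB
  have h3 := one_le_three_rpow hα
  have hB4 : 4 ≤ B := by
    have : 0 ≤ 3 * 3 ^ α + 3 ^ α * (4 * (K + 1)) := by positivity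
    linarith
  have hY1 : 1 ≤ (K + 1) * B * T := by
    have h1 : 1 ≤ (K + 1) * B := by nlinarith
    nlinarith
  -- The phase in which the transmission probability matches the average affectance.
  obtain ⟨k, hk₁, hk₂⟩ := exists_nat_pow_near hY1 (by norm_num : (1 : ℝ) < 2)
  set t₀ := ∑ j ∈ Finset.range (k + 1), phaseLength c₃ nHat j with ht₀
  set l := phaseLength c₃ nHat (k + 1) with hl
  set q := phaseProb (k + 1) with hq
  have hqmem := phaseProb_mem (k + 1)
  have hq0 : 0 < q := phaseProb_pos _
  refine ⟨t₀ + l, ?_, ?_⟩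
  · have hsum := sum_phaseLength_le hc nHat (k + 2)
    rw [Finset.sum_range_succ] at hsum
    have hlog : Real.log nHat ≤ ρ * Real.log n := by
      rw [← Real.log_rpow hn0]
      exact Real.log_le_log hnHat0 hn₂
    have hlog1 : 1 ≤ 2 * Real.log n := by
      have h1 : Real.log 2 ≤ Real.log n := Real.log_le_log (by norm_num) (by exact_mod_cast hn)
      linarith [Real.log_two_gt_d9]
    have hpow : (2 : ℝ) ^ (k + 2) ≤ 4 * ((K + 1) * B * T) := by
      rw [pow_add]
      linarith
    have hfac : 32 * c₃ * Real.log nHat + 1 ≤ (32 * c₃ * ρ + 2) * Real.log n := by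
      nlinarith [mul_le_mul_of_nonneg_left hlog hc.le]
    have hfac0 : 0 ≤ (32 * c₃ * ρ + 2) * Real.log n :=
      mul_nonneg (by positivity) (by linarith)
    calc cost * ((t₀ + l : ℕ) : ℝ) ≤ 2 * ((t₀ + l : ℕ) : ℝ) :=
          mul_le_mul_of_nonneg_right hcost (Nat.cast_nonneg _)
      _ ≤ 2 * ((32 * c₃ * Real.log nHat + 1) * 2 ^ (k + 2)) := by linarith
      _ ≤ 2 * ((32 * c₃ * ρ + 2) * Real.log n * (4 * ((K + 1) * B * T))) :=
          mul_le_mul_of_nonneg_left (mul_le_mul hfac hpow (by positivity) hfac0) (by norm_num)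
      _ = slotFactor c₃ α ρ K * Real.log n * T := by
          rw [slotFactor, ← hB]
          ring
  · have hstep : ∀ i < l, ∀ H : Fin n → History, (∀ v, (H v).length = t₀ + i) →
        expectation (transmitters fun v => (distributed c₃).transmitProb nHat (H v))
          (fun S => ((pending H \ ack S).card : ℝ≥0∞)) ≤
        ENNReal.ofReal (1 - q / 2) * (pending H).card := by
      intro i hi H hH
      have hph : phaseAt c₃ nHat (t₀ + i) = k + 1 := phaseAt_eq hlen hi
      have := expectation_card_pending_le hα hβ hN hP hfeas hmono hsub hK hack c₃ nHat hH
      rw [hph] at this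
      refine this ?_
      rw [← hB, ← hT, phaseProb, mul_one_div, div_le_div_iff₀ (by positivity) (by norm_num)]
      linarith
    have hexp := expectation_run_le l hstep
    -- The pending links die out: `n (1 - q / 2) ^ l ≤ n exp (-4 c₃ log nHat) ≤ n ^ (-κ)`.
    have hreal : (1 - q / 2) ^ l * n ≤ (n : ℝ) ^ (-κ) := by
      have h1 : (1 - q / 2) ^ l ≤ Real.exp (-(q / 2) * l) := by
        rw [mul_comm, Real.exp_nat_mul]
        refine pow_le_pow_left₀ (by linarith [hqmem.2]) ?_ _
        linarith [Real.add_one_le_exp (-(q / 2))]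
      have h2 : 8 * c₃ * Real.log nHat ≤ q * l := by
        rw [mul_comm q, ← div_le_iff₀ hq0]
        exact Nat.le_ceil _
      have h4 : Real.log n ≤ ρ * Real.log nHat := by
        have := Real.log_le_log (by positivity) hn₁
        rw [Real.log_rpow hn0, one_div, inv_mul_le_iff₀ (by positivity)] at this
        exact this
      have h5 : (1 + κ) * Real.log n ≤ q / 2 * l := by
        have := mul_le_mul_of_nonneg_left h4 (by positivity : 0 ≤ 1 + κ)
        rw [hc₃] at h2
        linarith
      have h6 : (1 - q / 2) ^ l ≤ (n : ℝ) ^ (-κ - 1) := by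
        rw [Real.rpow_def_of_pos hn0]
        exact h1.trans (Real.exp_le_exp.2 (by linarith))
      calc (1 - q / 2) ^ l * n ≤ (n : ℝ) ^ (-κ - 1) * n :=
            mul_le_mul_of_nonneg_right h6 hn0.le
        _ = (n : ℝ) ^ (-κ) := by
            rw [Real.rpow_sub_one hn0.ne']
            field_simp
    have hδ : expectation ((distributed c₃).run nHat ack (t₀ + l))
        (fun H => ((pending H).card : ℝ≥0∞)) ≤ ENNReal.ofReal ((n : ℝ) ^ (-κ)) := by
      refine hexp.trans ?_
      rw [← ENNReal.ofReal_natCast n, ← ENNReal.ofReal_pow (by linarith [hqmem.2]),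
        ← ENNReal.ofReal_mul (pow_nonneg (by linarith [hqmem.2]) _)]
      exact ENNReal.ofReal_le_ofReal hreal
    rw [ENNReal.ofReal_sub _ (by positivity), ENNReal.ofReal_one]
    refine one_sub_le_toOuterMeasure _ (fun H hH => ?_) hδ
    simp only [Set.mem_ofPred_eq, not_forall] at hH
    obtain ⟨v, hv⟩ := hH
    have : (pending H).Nonempty := ⟨v, by simpa [pending] using hv⟩
    exact_mod_cast Finset.card_pos.2 this

end SINR

theorem theorem1 (α β κ ρ : ℝ) (hα : 0 < α) (hβ : 1 ≤ β) (hκ : 0 < κ) (hρ : 1 ≤ ρ) :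
    ∃ c₃ C : ℝ, 0 < c₃ ∧ 0 < C ∧
      ∀ (N : ℝ), 0 ≤ N → ∀ (X : Type*) [MetricSpace X] (n : ℕ), 2 ≤ n →
      ∀ (L : SINR.LinkSet X n) (P : Fin n → ℝ) (nHat : ℕ),
        (n : ℝ) ^ (1 / ρ) ≤ nHat → (nHat : ℝ) ≤ (n : ℝ) ^ ρ →
        (∀ v, 0 < P v) →
        (∀ (m : SINR.LinkMode) (v : Fin n), SINR.Feasible m α β N L P {v}) →
        -- uniform power, uni-directional links, explicit acknowledgements with the same power
        (SINR.IsUniform P →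
          (SINR.distributed c₃).SchedulesWithin nHat (SINR.explicitAck .uni α β N L P P) 2
            (C * Real.log n * SINR.schedulingNumber .uni α β N L P) ((n : ℝ) ^ (-κ))) ∧
        -- linear power, uni-directional links, explicit acknowledgements with the dual power,
        -- normalized so that noise is no worse for the dual links
        (SINR.IsLinear α L P →
          ∀ γ : ℝ, 0 < γ → (∀ v, N / SINR.dualPower α γ L P v ≤ N / P v) →
          (SINR.distributed c₃).SchedulesWithin nHat
            (SINR.explicitAck .uni α β N L P (SINR.dualPower α γ L P)) 2
            (C * Real.log n * SINR.schedulingNumber .uni α β N L P) ((n : ℝ) ^ (-κ))) ∧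
        -- bi-directional links, explicit acknowledgements with the same power
        (SINR.LengthMonotone L P → SINR.SubLinear α L P →
          (SINR.distributed c₃).SchedulesWithin nHat (SINR.explicitAck .bi α β N L P P) 2
            (C * Real.log n * SINR.schedulingNumber .bi α β N L P) ((n : ℝ) ^ (-κ))) ∧
        -- free acknowledgements (`ε = 0`), or cheap ones that prolong each slot by a fraction `ε`
        (SINR.LengthMonotone L P → SINR.SubLinear α L P →
          ∀ (m : SINR.LinkMode) (ε : ℝ), 0 ≤ ε → ε ≤ 1 →
          (SINR.distributed c₃).SchedulesWithin nHat (SINR.freeAck m α β N L P) (1 + ε)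
            (C * Real.log n * SINR.schedulingNumber m α β N L P) ((n : ℝ) ^ (-κ))) := by
  have hk := SINR.one_le_three_rpow hα
  have hK : (0 : ℝ) ≤ 2 * 3 ^ α := by linarith
  refine ⟨ρ * (1 + κ) / 4, SINR.slotFactor (ρ * (1 + κ) / 4) α ρ (2 * 3 ^ α), by positivity,
    by unfold SINR.slotFactor; positivity, ?_⟩
  intro N hN X _ n hn L P nHat hn₁ hn₂ hP hfeas
  have hs : ∀ v, 0 ≤ SINR.slack α β N L P v := fun v =>
    SINR.slack_nonneg_of_feasible_singleton hβ (hfeas .uni v)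
  have main := fun (m : SINR.LinkMode) (h₁ : SINR.LengthMonotone L P)
      (h₂ : SINR.SubLinear α L P) (ack : Finset (Fin n) → Finset (Fin n))
      (hack : SINR.AckReliable m α β N L P (2 * 3 ^ α) ack) (cost : ℝ) (hcost : cost ≤ 2) =>
    SINR.schedulesWithin_of_ackReliable hα hβ hκ hρ hN hn hP (hfeas m) h₁ h₂ hn₁ hn₂ hK hack hcost
  refine ⟨fun hu => ?_, fun hlin γ hγ hγN => ?_, fun h₁ h₂ => ?_, fun h₁ h₂ m ε _ hε => ?_⟩
  · have hmono : SINR.LengthMonotone L P := by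
      obtain ⟨p, hp⟩ := hu
      exact fun v w _ => by rw [hp v, hp w]
    have hsub : SINR.SubLinear α L P := by
      intro v w h
      have hvw : P v = P w := by
        obtain ⟨p, hp⟩ := hu
        rw [hp v, hp w]
      rw [hvw]
      exact div_le_div_of_nonneg_left (hP w).le (SINR.length_rpow_pos L α w)
        (Real.rpow_le_rpow (L.length_pos w).le h hα.le)
    refine main .uni hmono hsub _ (SINR.ackReliable_explicitAck hα hβ hP (fun v => ?_)
      (SINR.affectance_dual_le_of_isUniform hα hβ hN hP hs hu)) 2 le_rfl
    simpa only [SINR.slack, SINR.length_dual] using hs v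
  · have hmono : SINR.LengthMonotone L P := by
      intro v w h
      obtain ⟨p, hp⟩ := hlin
      have hp0 : 0 < p := pos_of_mul_pos_left (hp v ▸ hP v) (SINR.length_rpow_pos L α v).le
      rw [hp v, hp w]
      exact mul_le_mul_of_nonneg_left (Real.rpow_le_rpow (L.length_pos w).le h hα.le) hp0.le
    have hsub : SINR.SubLinear α L P := by
      intro v w _
      obtain ⟨p, hp⟩ := hlin
      rw [hp v, hp w, mul_div_cancel_right₀ _ (SINR.length_rpow_pos L α v).ne',
        mul_div_cancel_right₀ _ (SINR.length_rpow_pos L α w).ne']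
    refine main .uni hmono hsub _ (SINR.ackReliable_explicitAck hα hβ
      (SINR.dualPower_pos hγ hP) (SINR.slack_dual_nonneg hβ hP hs hγ hγN) fun w v => ?_) 2 le_rfl
    have h1 := SINR.affectance_dual_le_of_isLinear (m := .uni) hβ hP hs hlin hγ hγN w v
    have h2 := SINR.affectance_nonneg (m := .uni) (α := α) (β := β) (N := N) (L := L) hP w v
    have h3 := SINR.affectance_nonneg (m := .uni) (α := α) (β := β) (N := N) (L := L) hP v w
    nlinarith
  · rw [SINR.explicitAck_bi hP hβ]
    exact main .bi h₁ h₂ _ (SINR.ackReliable_freeAck hP hK) 2 le_rfl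
  · exact main m h₁ h₂ _ (SINR.ackReliable_freeAck hP hK) (1 + ε) (by linarith)
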